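/- **Setting.** Let $\mathbb{R}^{4,2}$ be $\mathbb{R}^6$ (coordinates $x^0,\dots,x^5$, standard basis $e_0,\dots,e_5$) with the bilinear form $\langle x,y\rangle=-(x^0y^5+x^5y^0)-(x^1y^4+x^4y^1)+x^2y^2+x^3y^3={}^t\!x\,h\,y$ of signature $(4,2)$. Let $G$ be the identity component of $\mathrm{O}(4,2)=\{A\in\mathrm{GL}(6,\mathbb{R}) : {}^t\!A\,h\,A=h\}$, and let $\Lambda$ be the 5-dimensional manifold of null 2-planes of $\mathbb{R}^{4,2}$, on which $G$ acts. Let $J\subset\mathbb{R}$ be an open interval and $\gamma:J\to\Lambda$ a smooth curve. A *Lie frame field* along $\gamma$ on an open set $I\subset J$ is a smooth map $A:I\to G$ with columns $A_j=Ae_j$ such that $\gamma(t)=\operatorname{span}(A_0(t),A_1(t))$ for all $t\in I$; write $\theta=(\theta^i_j)=A^{-1}dA$, $0\le i,j\le 5$. The curve $\gamma$ is *transversal* if it is immersed and $\theta^4_0\neq0$ at every point for every Lie frame field along it. A Lie frame field is - of *first order* if $\theta^4_0=\rho\,dt$ with $\rho>0$ and $\theta^2_0=\theta^2_1=\theta^3_0=\theta^3_1=0$;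 one then defines the $2\times2$ matrix $P$ by $\begin{pmatrix}\theta^2_4&\theta^2_5\\ \theta^3_4&\theta^3_5\end{pmatrix}=P\,\theta^4_0$; - of *second order* if it is of first order and $P=I_2$; - of *third order* if it is of second order and $\theta^0_0+\theta^1_1=0$; one then defines $p,q$ by $\tfrac12(\theta^0_1+\theta^1_0)=p\,\theta^4_0$ and $\theta^1_1=q\,\theta^4_0$; - of *fourth order* if it is of third order and $p=0$. A transversal curve is *generic* if around every point of $J$ there is a first order frame field with $\det P\neq0$ at that point, and a third order frame field with $p^2+q^2>0$ at that point. A function $s:J\to\mathbb{R}$ is *the Lie arclength* of $\gamma$ (determined up to an additive constant) if around every point of $J$ there is a second order frame field with $\theta^4_0=ds$. Functions $\kappa_1,\dots,\kappa_4:J\to\mathbb{R}$ are *the Lie curvatures* of $\gamma$ if around every point of $J$ there is a fourth order frame field with $\theta^0_0=\kappa_1\theta^4_0$, $\theta^1_0=\kappa_2\theta^4_0$, $\theta^3_2=\kappa_3\theta^4_0$, $\theta^0_4=\kappa_4\theta^4_0$. **Theorem A.** Let $s:J\to\mathbb{R}$ be a smooth function with $s'(t)>0$ for every $t\in J$, and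 let $\kappa_1,\kappa_2,\kappa_3,\kappa_4:J\to\mathbb{R}$ be smooth functions with $\kappa_1(t)\neq0$ for every $t\in J$. Then there exists a generic transversal curve $\gamma:J\to\Lambda$ for which $s$ is the Lie arclength and $\kappa_1,\kappa_2,\kappa_3,\kappa_4$ are the Lie curvatures. Moreover $\gamma$ is unique up to left multiplication by an element of $G$: if $\gamma,\gamma':J\to\Lambda$ are two such curves, there is $g\in G$ with $\gamma'(t)=g\,\gamma(t)$ for all $t\in J$. -/

import Mathlib

open scoped ContDiff

noncomputable section

namespace LieSphere

/-- The matrix `h` of the bilinear form of signature `(4,2)` on `ℝ⁶`, coordinates numbered `0,…,5`. -/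
def h : Matrix (Fin 6) (Fin 6) ℝ :=
  !![ 0,  0, 0, 0,  0, -1;
      0,  0, 0, 0, -1,  0;
      0,  0, 1, 0,  0,  0;
      0,  0, 0, 1,  0,  0;
      0, -1, 0, 0,  0,  0;
     -1,  0, 0, 0,  0,  0]

/-- `⟨x, y⟩ = -(x⁰y⁵ + x⁵y⁰) - (x¹y⁴ + x⁴y¹) + x²y² + x³y³`. -/
def lieForm (x y : Fin 6 → ℝ) : ℝ := dotProduct x (h.mulVec y)

theorem lieForm_eq (x y : Fin 6 → ℝ) :
    lieForm x y =
      -(x 0 * y 5 + x 5 * y 0) - (x 1 * y 4 + x 4 * y 1) + x 2 * y 2 + x 3 * y 3 := by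
  simp [lieForm, h, dotProduct, Matrix.mulVec, Fin.sum_univ_six]
  ring

/-- The pseudo-orthogonal group `O(4,2)` of the form, as a set of matrices. -/
def O42 : Set (Matrix (Fin 6) (Fin 6) ℝ) := {A | A.transpose * h * A = h}

/-- The identity component `G` of `O(4,2)`. -/
def G : Set (Matrix (Fin 6) (Fin 6) ℝ) := connectedComponentIn O42 1

/-- The space `Λ` of null 2-planes (through the origin) of `ℝ^{4,2}`. -/
def NullPlane : Type :=
  {W : Submodule ℝ (Fin 6 → ℝ) //
    Module.finrank ℝ W = 2 ∧ ∀ x ∈ W, ∀ y ∈ W, lieForm x y = 0}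

/-- On the open set `I`, `u` and `v` are smooth vector functions spanning the planes `γ t`. -/
def IsSmoothSpanningPair (γ : ℝ → NullPlane) (I : Set ℝ) (u v : ℝ → Fin 6 → ℝ) : Prop :=
  ContDiffOn ℝ ∞ u I ∧ ContDiffOn ℝ ∞ v I ∧
    ∀ t ∈ I, (γ t).1 = Submodule.span ℝ {u t, v t}

/-- A curve of 2-planes is smooth on the open set `J` if it is locally spanned by two smooth
vector functions. -/
def IsSmoothCurve (J : Set ℝ) (γ : ℝ → NullPlane) : Prop :=
  ∀ t ∈ J, ∃ I : Set ℝ, IsOpen I ∧ t ∈ I ∧ I ⊆ J ∧ ∃ u v, IsSmoothSpanningPair γ I u v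

/-- The curve is immersed. The velocity of `γ = span {u, v}` in the Grassmannian at `t` is the
linear map `γ t → ℝ⁶ / γ t` sending `u t`, `v t` to the classes of `u' t`, `v' t`. -/
def IsImmersed (J : Set ℝ) (γ : ℝ → NullPlane) : Prop :=
  ∀ (I : Set ℝ) (u v : ℝ → Fin 6 → ℝ), IsOpen I → I ⊆ J → IsSmoothSpanningPair γ I u v →
    ∀ t ∈ I, ¬ (deriv u t ∈ (γ t).1 ∧ deriv v t ∈ (γ t).1)

/-- `A` is a Lie frame field along `γ` on the open set `I`: a smooth map `I → G` with
`γ t = [A₀ t, A₁ t]`, where `A_j` is the `j`-th column of `A`. -/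
structure IsLieFrame (γ : ℝ → NullPlane) (I : Set ℝ) (A : ℝ → Matrix (Fin 6) (Fin 6) ℝ) :
    Prop where
  isOpen : IsOpen I
  mem_G : ∀ t ∈ I, A t ∈ G
  smooth : ∀ i j, ContDiffOn ℝ ∞ (fun t => A t i j) I
  span_eq : ∀ t ∈ I, (γ t).1 = Submodule.span ℝ {(A t).col 0, (A t).col 1}

/-- The pullback `A⁻¹ dA` of the Maurer–Cartan form: `theta A t i j` is the coefficient at `t` of
`dt` in the 1-form `θ^i_j`. -/
def theta (A : ℝ → Matrix (Fin 6) (Fin 6) ℝ) (t : ℝ) : Matrix (Fin 6) (Fin 6) ℝ :=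
  (A t)⁻¹ * Matrix.of (fun i j => deriv (fun r => A r i j) t)

/-- Transversal curves (T-curves): smooth immersed curves on which no contact form
`A^*(ω^4_0)` vanishes. -/
structure IsTCurve (J : Set ℝ) (γ : ℝ → NullPlane) : Prop where
  smooth : IsSmoothCurve J γ
  immersed : IsImmersed J γ
  transversal : ∀ (I : Set ℝ) (A : ℝ → Matrix (Fin 6) (Fin 6) ℝ), I ⊆ J → IsLieFrame γ I A →
    ∀ t ∈ I, theta A t 4 0 ≠ 0

/-- First order Lie frame fields. -/
structure IsFirstOrderFrame (γ : ℝ → NullPlane) (I : Set ℝ)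
    (A : ℝ → Matrix (Fin 6) (Fin 6) ℝ) : Prop extends IsLieFrame γ I A where
  pos : ∀ t ∈ I, 0 < theta A t 4 0
  h20 : ∀ t ∈ I, theta A t 2 0 = 0
  h21 : ∀ t ∈ I, theta A t 2 1 = 0
  h30 : ∀ t ∈ I, theta A t 3 0 = 0
  h31 : ∀ t ∈ I, theta A t 3 1 = 0

/-- The `2 × 2` matrix `P` of a first order frame:
`(θ^2_4, θ^2_5; θ^3_4, θ^3_5) = P θ^4_0`. -/
def P (A : ℝ → Matrix (Fin 6) (Fin 6) ℝ) (t : ℝ) : Matrix (Fin 2) (Fin 2) ℝ :=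
  (theta A t 4 0)⁻¹ •
    !![theta A t 2 4, theta A t 2 5; theta A t 3 4, theta A t 3 5]

/-- Nondegenerate T-curves: `det P ≠ 0` at every point (the rank of `P` does not depend on the
first order frame). -/
def IsNondegenerate (J : Set ℝ) (γ : ℝ → NullPlane) : Prop :=
  IsTCurve J γ ∧ ∀ t ∈ J, ∃ (I : Set ℝ) (A : ℝ → Matrix (Fin 6) (Fin 6) ℝ),
    t ∈ I ∧ I ⊆ J ∧ IsFirstOrderFrame γ I A ∧ (P A t).det ≠ 0

/-- Second order Lie frame fields. -/
structure IsSecondOrderFrame (γ : ℝ → NullPlane) (I : Set ℝ)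
    (A : ℝ → Matrix (Fin 6) (Fin 6) ℝ) : Prop extends IsFirstOrderFrame γ I A where
  P_eq : ∀ t ∈ I, P A t = 1

/-- `s` is the Lie arclength (determined up to a constant): `ds = θ^4_0` for second order
frames. -/
def IsLieArclength (J : Set ℝ) (γ : ℝ → NullPlane) (s : ℝ → ℝ) : Prop :=
  ∀ t ∈ J, ∃ (I : Set ℝ) (A : ℝ → Matrix (Fin 6) (Fin 6) ℝ),
    t ∈ I ∧ I ⊆ J ∧ IsSecondOrderFrame γ I A ∧ ∀ r ∈ I, HasDerivAt s (theta A r 4 0) r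

/-- Third order Lie frame fields. -/
structure IsThirdOrderFrame (γ : ℝ → NullPlane) (I : Set ℝ)
    (A : ℝ → Matrix (Fin 6) (Fin 6) ℝ) : Prop extends IsSecondOrderFrame γ I A where
  trace_eq : ∀ t ∈ I, theta A t 0 0 + theta A t 1 1 = 0

/-- The function `p` of a third order frame: `(θ^0_1 + θ^1_0) / 2 = p θ^4_0`. -/
def p (A : ℝ → Matrix (Fin 6) (Fin 6) ℝ) (t : ℝ) : ℝ :=
  ((theta A t 0 1 + theta A t 1 0) / 2) / theta A t 4 0

/-- The function `q` of a third order frame: `θ^1_1 = q θ^4_0`. -/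
def q (A : ℝ → Matrix (Fin 6) (Fin 6) ℝ) (t : ℝ) : ℝ := theta A t 1 1 / theta A t 4 0

/-- Generic T-curves: nondegenerate, with `p² + q² > 0` at every point (the value of `p² + q²`
does not depend on the third order frame). -/
def IsGeneric (J : Set ℝ) (γ : ℝ → NullPlane) : Prop :=
  IsNondegenerate J γ ∧ ∀ t ∈ J, ∃ (I : Set ℝ) (A : ℝ → Matrix (Fin 6) (Fin 6) ℝ),
    t ∈ I ∧ I ⊆ J ∧ IsThirdOrderFrame γ I A ∧ 0 < p A t ^ 2 + q A t ^ 2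

/-- Fourth order Lie frame fields. -/
structure IsFourthOrderFrame (γ : ℝ → NullPlane) (I : Set ℝ)
    (A : ℝ → Matrix (Fin 6) (Fin 6) ℝ) : Prop extends IsThirdOrderFrame γ I A where
  p_eq : ∀ t ∈ I, p A t = 0

/-- `κ₁, κ₂, κ₃, κ₄` are the Lie curvatures of `γ`: around every point there is a fourth order
frame with `θ^0_0 = κ₁ ds`, `θ^1_0 = κ₂ ds`, `θ^3_2 = κ₃ ds`, `θ^0_4 = κ₄ ds`, where
`ds = θ^4_0`. -/
def AreLieCurvatures (J : Set ℝ) (γ : ℝ → NullPlane) (κ₁ κ₂ κ₃ κ₄ : ℝ → ℝ) : Prop :=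
  ∀ t ∈ J, ∃ (I : Set ℝ) (A : ℝ → Matrix (Fin 6) (Fin 6) ℝ),
    t ∈ I ∧ I ⊆ J ∧ IsFourthOrderFrame γ I A ∧ ∀ r ∈ I,
      theta A r 0 0 = κ₁ r * theta A r 4 0 ∧
      theta A r 1 0 = κ₂ r * theta A r 4 0 ∧
      theta A r 3 2 = κ₃ r * theta A r 4 0 ∧
      theta A r 0 4 = κ₄ r * theta A r 4 0

end LieSphere

end

/-! The normalizations of a fourth order frame fix ten of the fifteen coordinates of its
Maurer–Cartan matrix; the other five are `ρ = s'` and the curvatures times `ρ` (`eq_curvatureForm`).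
The theorem is therefore a statement about the linear equation `F' = F X`, where `X` is the
prescribed `curvatureForm`.

Existence: by linearity the equation has a solution on all of `J`. It stays in `O(4,2)` because `X`
lies in the Lie algebra, and in `G` because `J` is connected (`exists_frame`). The planes spanned by
the first two columns of `F` form `γ`, with `F` as a fourth order frame; immersion and
transversality come from `X 4 0 ≠ 0`.

Uniqueness: a local frame of any such curve solves the same equation, so it is `c F` with `c ∈ G`
constant. Frames are given only locally, so these constants must be compared. If `c F` and `c' F`
span the same planes on an open set, the change of frame `k` satisfies `k' = k X - X k` and
preserves the plane of `e₀, e₁`; differentiating linear relations among its entries over and over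
makes `k` scalar, by `κ₁ ≠ 0` (`eq_smul_one`). Scalars do not move planes, so by connectedness one
`c` serves all of `J`. Comparing both curves with `F` gives `g = c' c⁻¹`. The same differentiation
for two different forms shows that `θ^4_0` is common to all second order frames
(`second_order_relations`); this reconciles the frames defining `s` with those defining the
curvatures. -/

noncomputable section

namespace LieSphere

open Set Filter Topology

local notation "M₆" => Matrix (Fin 6) (Fin 6) ℝ

/-! ### Linear differential equations on an interval -/

section LinearEquations

open MeasureTheory
open scoped Matrix.Norms.Operator

variable {𝔸 : Type*} [NormedRing 𝔸] [NormedAlgebra ℝ 𝔸]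

/-- The terms of the Peano–Baker series of the equation `F' = F X`. -/
def peanoBaker (X : ℝ → 𝔸) (t₀ : ℝ) : ℕ → ℝ → 𝔸
  | 0 => fun _ => 1
  | n + 1 => fun t => ∫ r in t₀..t, peanoBaker X t₀ n r * X r

theorem peanoBaker_self (X : ℝ → 𝔸) (t₀ : ℝ) (n : ℕ) :
    peanoBaker X t₀ (n + 1) t₀ = 0 := by
  simp [peanoBaker]

theorem continuousOn_peanoBaker_and_hasDerivAt [CompleteSpace 𝔸] {X : ℝ → 𝔸} {J : Set ℝ}
    (hJ : IsOpen J)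
    (hJc : IsPreconnected J) {t₀ : ℝ} (ht₀ : t₀ ∈ J) (hX : ContinuousOn X J) (n : ℕ) :
    ContinuousOn (peanoBaker X t₀ n) J ∧ ∀ t ∈ J,
      HasDerivAt (peanoBaker X t₀ (n + 1)) (peanoBaker X t₀ n t * X t) t := by
  have step : ∀ n, ContinuousOn (peanoBaker X t₀ n) J → ∀ t ∈ J,
      HasDerivAt (peanoBaker X t₀ (n + 1)) (peanoBaker X t₀ n t * X t) t := by
    intro n hn t ht
    have hc : ContinuousOn (fun r => peanoBaker X t₀ n r * X r) J := hn.mul hX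
    have hsub : uIcc t₀ t ⊆ J := hJc.ordConnected.uIcc_subset ht₀ ht
    exact intervalIntegral.integral_hasDerivAt_right
      ((hc.mono hsub).intervalIntegrable)
      (hc.stronglyMeasurableAtFilter hJ t ht) (hc.continuousAt (hJ.mem_nhds ht))
  have hcont : ContinuousOn (peanoBaker X t₀ n) J := by
    induction n with
    | zero => exact continuousOn_const
    | succ n ih => exact fun t ht => (step n ih t ht).continuousAt.continuousWithinAt
  exact ⟨hcont, step n hcont⟩

/-- Each iterated integration contributes a factor `C` and raises the power of `|t - t₀|`, as in the
exponential series. -/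
theorem norm_peanoBaker_le [CompleteSpace 𝔸] [NormOneClass 𝔸] {X : ℝ → 𝔸} {I : Set ℝ}
    (hI : OrdConnected I)
    {t₀ : ℝ} (ht₀ : t₀ ∈ I) {C : ℝ} (hC : 0 ≤ C) (hX : ∀ t ∈ I, ‖X t‖ ≤ C) (n : ℕ) :
    ∀ t ∈ I, ‖peanoBaker X t₀ n t‖ ≤ C ^ n * |t - t₀| ^ n / n.factorial := by
  induction n with
  | zero => intro t _; simp [peanoBaker]
  | succ n ih =>
    intro t ht
    have hsub : uIcc t₀ t ⊆ I := hI.uIcc_subset ht₀ ht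
    have hb : ∀ r ∈ uIoc t₀ t, ‖peanoBaker X t₀ n r * X r‖ ≤
        C ^ (n + 1) / n.factorial * |r - t₀| ^ n := by
      intro r hr
      have hr' := hsub (uIoc_subset_uIcc hr)
      calc ‖peanoBaker X t₀ n r * X r‖ ≤ ‖peanoBaker X t₀ n r‖ * ‖X r‖ := norm_mul_le _ _
        _ ≤ (C ^ n * |r - t₀| ^ n / n.factorial) * C :=
          mul_le_mul (ih r hr') (hX r hr') (norm_nonneg _) (by positivity)
        _ = _ := by ring
    have hmain : ‖∫ r in t₀..t, peanoBaker X t₀ n r * X r‖ ≤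
        |∫ r in t₀..t, C ^ (n + 1) / n.factorial * |r - t₀| ^ n| := by
      apply intervalIntegral.norm_integral_le_abs_of_norm_le
      · exact ae_restrict_of_forall_mem measurableSet_uIoc hb
      · exact Continuous.intervalIntegrable (by fun_prop) _ _
    have hint : |∫ r in t₀..t, |r - t₀| ^ n| = |t - t₀| ^ (n + 1) / (n + 1) := by
      rcases le_total t₀ t with h | h
      · have : ∫ r in t₀..t, |r - t₀| ^ n = ∫ r in t₀..t, (r - t₀) ^ n := by
          apply intervalIntegral.integral_congr
          intro r hr
          rw [uIcc_of_le h] at hr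
          simp only [abs_of_nonneg (sub_nonneg.2 hr.1)]
        rw [this, intervalIntegral.integral_comp_sub_right (fun r => r ^ n), integral_pow]
        simp only [sub_self, ne_eq, Nat.succ_ne_zero, not_false_eq_true, zero_pow, sub_zero]
        rw [abs_div, abs_pow, abs_of_nonneg (show (0 : ℝ) ≤ n + 1 by positivity)]
      · have : ∫ r in t₀..t, |r - t₀| ^ n = ∫ r in t₀..t, (t₀ - r) ^ n := by
          apply intervalIntegral.integral_congr
          intro r hr
          rw [uIcc_of_ge h] at hr
          simp only [abs_of_nonpos (sub_nonpos.2 hr.2), neg_sub]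
        rw [this, intervalIntegral.integral_comp_sub_left (fun r => r ^ n), integral_pow]
        simp only [sub_self, ne_eq, Nat.succ_ne_zero, not_false_eq_true, zero_pow, zero_sub]
        rw [abs_div, abs_neg, abs_pow, abs_of_nonneg (show (0 : ℝ) ≤ n + 1 by positivity),
          abs_sub_comm]
    refine hmain.trans ?_
    rw [intervalIntegral.integral_const_mul, abs_mul, hint,
      abs_of_nonneg (show 0 ≤ C ^ (n + 1) / (n.factorial : ℝ) by positivity),
      Nat.factorial_succ]
    apply le_of_eq
    push_cast
    field_simp

/-- A linear equation `F' = F X` with coefficients continuous on an open interval has a solution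
on the whole interval. -/
theorem exists_hasDerivAt_mul [CompleteSpace 𝔸] [NormOneClass 𝔸] {X : ℝ → 𝔸} {J : Set ℝ}
    (hJ : IsOpen J)
    (hJc : IsPreconnected J) {t₀ : ℝ} (ht₀ : t₀ ∈ J) (hX : ContinuousOn X J) :
    ∃ F : ℝ → 𝔸, F t₀ = 1 ∧ ∀ t ∈ J, HasDerivAt F (F t * X t) t := by
  refine ⟨fun t => ∑' n, peanoBaker X t₀ n t, ?_, ?_⟩
  · dsimp only
    rw [tsum_eq_single 0]
    · rfl
    · intro n hn
      obtain ⟨m, rfl⟩ := Nat.exists_eq_succ_of_ne_zero hn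
      exact peanoBaker_self X t₀ m
  · intro t ht
    -- `X` may be unbounded on `J`, so the series is differentiated on a compact subinterval
    -- containing `t₀` and `t` in its interior.
    obtain ⟨a, b, hab, hJab⟩ : ∃ a b, uIcc t₀ t ⊆ Ioo a b ∧ Icc a b ⊆ J := by
      have hmin : min t₀ t ∈ J := by rcases min_choice t₀ t with h | h <;> rwa [h]
      have hmax : max t₀ t ∈ J := by rcases max_choice t₀ t with h | h <;> rwa [h]
      obtain ⟨ε, hε, h1⟩ := Metric.isOpen_iff.1 hJ _ hmin
      obtain ⟨δ, hδ, h2⟩ := Metric.isOpen_iff.1 hJ _ hmax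
      refine ⟨min t₀ t - ε / 2, max t₀ t + δ / 2, ?_, ?_⟩
      · intro r hr
        exact ⟨by linarith [hr.1], by linarith [hr.2]⟩
      · apply hJc.ordConnected.out
        · apply h1
          rw [Metric.mem_ball, Real.dist_eq, sub_sub_cancel_left, abs_neg, abs_of_pos] <;> linarith
        · apply h2
          rw [Metric.mem_ball, Real.dist_eq, add_sub_cancel_left, abs_of_pos] <;> linarith
    obtain ⟨C, hC⟩ := isCompact_Icc.exists_bound_of_continuousOn (hX.mono hJab)
    have ht₀' := hab left_mem_uIcc
    have ht' := hab right_mem_uIcc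
    have hC0 : 0 ≤ C := (norm_nonneg _).trans (hC t (Ioo_subset_Icc_self ht'))
    have hbase := fun n => continuousOn_peanoBaker_and_hasDerivAt hJ hJc ht₀ hX n
    have hle := norm_peanoBaker_le ordConnected_Ioo ht₀' hC0
      (fun r hr => hC r (Ioo_subset_Icc_self hr))
    have hle' : ∀ n, ∀ r ∈ Ioo a b, ‖peanoBaker X t₀ n r‖ ≤ (C * (b - a)) ^ n / n.factorial := by
      intro n r hr
      refine (hle n r hr).trans ?_
      rw [mul_pow]
      have : |r - t₀| ≤ b - a := by
        rw [abs_le]; constructor <;> linarith [hr.1, hr.2, ht₀'.1, ht₀'.2]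
      gcongr
    -- Indices shift by one: the constant zeroth term has derivative 0, and the term `n + 1` has
    -- derivative (term `n`) times `X`. The series of derivatives is thus the original series times
    -- `X`.
    let g' : ℕ → ℝ → 𝔸
      | 0 => fun _ => 0
      | n + 1 => fun t => peanoBaker X t₀ n t * X t
    let u : ℕ → ℝ
      | 0 => 0
      | n + 1 => (C * (b - a)) ^ n / n.factorial * C
    have hu : Summable u := by
      rw [← summable_nat_add_iff 1]
      exact (Real.summable_pow_div_factorial _).mul_right C
    have key := hasDerivAt_tsum_of_isPreconnected (g := peanoBaker X t₀) (g' := g') hu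
      isOpen_Ioo isPreconnected_Ioo (y₀ := t₀) (y := t) ?_ ?_ ht₀' ?_ ht'
    · convert! key using 1
      have hs : Summable fun n => peanoBaker X t₀ n t :=
        Summable.of_norm_bounded (Real.summable_pow_div_factorial (C * (b - a)))
          fun n => hle' n t ht'
      have hg : Summable fun n => g' n t := by
        rw [← summable_nat_add_iff 1]
        exact hs.mul_right (X t)
      rw [hg.tsum_eq_zero_add]
      exact ((zero_add _).trans (hs.tsum_mul_right (X t))).symm
    · intro n r hr
      cases n with
      | zero => exact hasDerivAt_const r 1
      | succ n => exact (hbase n).2 r (hJab (Ioo_subset_Icc_self hr))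
    · intro n r hr
      cases n with
      | zero => simp [g', u]
      | succ n =>
        refine (norm_mul_le _ _).trans ?_
        exact mul_le_mul (hle' n r hr) (hC r (Ioo_subset_Icc_self hr)) (norm_nonneg _)
          ((norm_nonneg _).trans (hle' n r hr))
    · exact summable_of_ne_finset_zero (s := {0}) fun n hn => by
        obtain ⟨m, rfl⟩ := Nat.exists_eq_succ_of_ne_zero (by simpa using hn)
        exact peanoBaker_self X t₀ m

theorem hasDerivAt_matrix {A : ℝ → M₆} {A' : M₆}
    {t : ℝ} : HasDerivAt A A' t ↔ ∀ i j, HasDerivAt (fun r => A r i j) (A' i j) t := by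
  constructor
  · intro hA i j
    exact ((Matrix.entryLinearMap ℝ ℝ i j).toContinuousLinearMap.hasFDerivAt.comp_hasDerivAt t hA)
  · intro hA
    have := HasDerivAt.fun_sum (u := Finset.univ) fun i _ => HasDerivAt.fun_sum (u := Finset.univ)
      fun j _ => (hA i j).smul_const (Matrix.single i j (1 : ℝ))
    simp only [Matrix.smul_single, smul_eq_mul, mul_one, ← Matrix.matrix_eq_sum_single] at this
    exact this

theorem continuousOn_matrix {A : ℝ → M₆} {J : Set ℝ}
    (hA : ∀ i j, ContinuousOn (fun r => A r i j) J) : ContinuousOn A J :=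
  continuousOn_pi.2 fun i => continuousOn_pi.2 fun j => hA i j

theorem exists_matrix_hasDerivAt_mul {X : ℝ → M₆} {J : Set ℝ}
    (hJ : IsOpen J) (hJc : IsPreconnected J) {t₀ : ℝ} (ht₀ : t₀ ∈ J)
    (hX : ∀ i j, ContinuousOn (fun t => X t i j) J) :
    ∃ F : ℝ → M₆, F t₀ = 1 ∧ ∀ t ∈ J, HasDerivAt F (F t * X t) t :=
  exists_hasDerivAt_mul hJ hJc ht₀ (continuousOn_matrix hX)

end LinearEquations

/-! ### Calculus of matrix-valued functions -/

section Calculus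
open scoped Matrix.Norms.Operator

theorem hasDerivAt_matrix_mul {A B : ℝ → M₆} {A' B' : M₆} {t : ℝ}
    (hA : HasDerivAt A A' t) (hB : HasDerivAt B B' t) :
    HasDerivAt (fun r => A r * B r) (A' * B t + A t * B') t :=
  HasDerivAt.mul (𝔸 := M₆) hA hB

theorem hasDerivAt_matrix_unique {A : ℝ → M₆} {A' B' : M₆} {t : ℝ}
    (hA : HasDerivAt A A' t) (hB : HasDerivAt A B' t) : A' = B' :=
  HasDerivAt.unique (F := M₆) hA hB

theorem continuousOn_of_hasDerivAt_matrix {A A' : ℝ → M₆} {I : Set ℝ}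
    (hA : ∀ t ∈ I, HasDerivAt A (A' t) t) : ContinuousOn A I :=
  fun t ht => (HasDerivAt.continuousAt (F := M₆) (hA t ht)).continuousWithinAt

theorem eqOn_of_hasDerivAt_zero {A : ℝ → M₆} {I : Set ℝ} (hI : IsOpen I) (hIc : IsPreconnected I)
    (hA : ∀ t ∈ I, HasDerivAt A 0 t) {t r : ℝ} (ht : t ∈ I) (hr : r ∈ I) : A t = A r := by
  ext i j
  refine hI.is_const_of_deriv_eq_zero (f := fun r => A r i j) hIc ?_ ?_ ht hr
  · exact fun x hx => ((hasDerivAt_matrix.1 (hA x hx) i j).differentiableAt).differentiableWithinAt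
  · exact fun x hx => (hasDerivAt_matrix.1 (hA x hx) i j).deriv

end Calculus

theorem hasDerivAt_transpose {A : ℝ → M₆} {A' : M₆} {t : ℝ} (hA : HasDerivAt A A' t) :
    HasDerivAt (fun r => (A r).transpose) A'.transpose t :=
  hasDerivAt_matrix.2 fun i j => hasDerivAt_matrix.1 hA j i

theorem hasDerivAt_const_mul {A : ℝ → M₆} {A' : M₆} {t : ℝ} (C : M₆) (hA : HasDerivAt A A' t) :
    HasDerivAt (fun r => C * A r) (C * A') t := by
  have := hasDerivAt_matrix_mul (hasDerivAt_matrix.2 fun i j => hasDerivAt_const t (C i j)) hA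
    (A' := 0)
  simpa using this

/-! ### The groups `O(4,2)` and `G` -/

section Group

theorem h_mul_h : h * h = 1 := by
  ext i j
  fin_cases i <;> fin_cases j <;> simp [h, Matrix.mul_apply, Fin.sum_univ_six]

theorem h_transpose : h.transpose = h := by
  ext i j
  fin_cases i <;> fin_cases j <;> simp [h]

/-- The inverse of an element of `O(4,2)`. -/
def formInv (A : M₆) : M₆ := h * A.transpose * h

theorem formInv_mul {A : M₆} (hA : A ∈ O42) : formInv A * A = 1 := by
  have hA' : A.transpose * h * A = h := hA
  rw [formInv, Matrix.mul_assoc, Matrix.mul_assoc, ← Matrix.mul_assoc A.transpose, hA', h_mul_h]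

theorem mul_formInv {A : M₆} (hA : A ∈ O42) : A * formInv A = 1 :=
  mul_eq_one_comm.1 (formInv_mul hA)

theorem inv_eq_formInv {A : M₆} (hA : A ∈ O42) : A⁻¹ = formInv A :=
  Matrix.inv_eq_left_inv (formInv_mul hA)

theorem one_mem_O42 : (1 : M₆) ∈ O42 := by simp [O42]

theorem mul_mem_O42 {A B : M₆} (hA : A ∈ O42) (hB : B ∈ O42) : A * B ∈ O42 := by
  have hA' : A.transpose * h * A = h := hA
  have hB' : B.transpose * h * B = h := hB
  change (A * B).transpose * h * (A * B) = h
  calc (A * B).transpose * h * (A * B) = B.transpose * (A.transpose * h * A) * B := by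
        simp only [Matrix.transpose_mul, Matrix.mul_assoc]
    _ = h := by rw [hA', hB']

theorem formInv_mem_O42 {A : M₆} (hA : A ∈ O42) : formInv A ∈ O42 := by
  have hA' : A * (h * A.transpose * h) = 1 := mul_formInv hA
  change (h * A.transpose * h).transpose * h * (h * A.transpose * h) = h
  calc (h * A.transpose * h).transpose * h * (h * A.transpose * h)
      = h * A * (h * h) * h * A.transpose * h := by
        simp only [Matrix.transpose_mul, Matrix.transpose_transpose, h_transpose, Matrix.mul_assoc]
    _ = h * (A * (h * A.transpose * h)) := by
        rw [h_mul_h]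
        simp only [Matrix.mul_one, Matrix.mul_assoc]
    _ = h := by rw [hA', Matrix.mul_one]

theorem mem_O42_of_mul {A : M₆} (hA : A * h * A.transpose = h) : A ∈ O42 := by
  have h1 : formInv A * A = 1 := by
    rw [mul_eq_one_comm, formInv, ← Matrix.mul_assoc, ← Matrix.mul_assoc, hA, h_mul_h]
  calc A.transpose * h * A = (h * h) * A.transpose * h * A := by rw [h_mul_h, Matrix.one_mul]
    _ = h * (formInv A * A) := by simp only [formInv, Matrix.mul_assoc]
    _ = h := by rw [h1, Matrix.mul_one]

theorem mul_h_mul_transpose {A : M₆} (hA : A ∈ O42) : A * h * A.transpose = h := by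
  calc A * h * A.transpose = A * formInv A * h := by
        simp only [formInv, Matrix.mul_assoc, h_mul_h, Matrix.mul_one]
    _ = h := by rw [mul_formInv hA, Matrix.one_mul]

theorem O42_apply {A : M₆} (hA : A ∈ O42) (i j : Fin 6) :
    -(A 0 i * A 5 j + A 5 i * A 0 j) - (A 1 i * A 4 j + A 4 i * A 1 j) + A 2 i * A 2 j
      + A 3 i * A 3 j = h i j := by
  have hA' : A.transpose * h * A = h := hA
  rw [← congrFun (congrFun hA' i) j]
  simp [Matrix.mul_apply, h, Fin.sum_univ_six]
  ring

theorem one_mem_G : (1 : M₆) ∈ G := mem_connectedComponentIn one_mem_O42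

theorem mem_O42_of_mem_G {A : M₆} (hA : A ∈ G) : A ∈ O42 := connectedComponentIn_subset _ _ hA

/-- The translate `A S` is connected, lies in `O(4,2)` and contains `A B = 1`, hence lies in the
identity component. Used with `S = G` for the group laws, and with `S` the image of a solution curve
to place that curve in `G`. -/
theorem mul_mem_G_of_mem {S : Set M₆} (hS : IsPreconnected S) (hSO : S ⊆ O42) {A B C : M₆}
    (hA : A ∈ O42) (hB : B ∈ S) (hAB : A * B = 1) (hC : C ∈ S) : A * C ∈ G := by
  have hpre : IsPreconnected ((fun x => A * x) '' S) :=
    hS.image _ (continuous_const.matrix_mul continuous_id).continuousOn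
  refine hpre.subset_connectedComponentIn ⟨B, hB, hAB⟩ ?_ ⟨C, hC, rfl⟩
  rintro _ ⟨x, hx, rfl⟩
  exact mul_mem_O42 hA (hSO hx)

theorem formInv_mul_mem_G {A B : M₆} (hA : A ∈ G) (hB : B ∈ G) : formInv A * B ∈ G :=
  mul_mem_G_of_mem isPreconnected_connectedComponentIn (connectedComponentIn_subset _ _)
    (formInv_mem_O42 (mem_O42_of_mem_G hA)) hA (formInv_mul (mem_O42_of_mem_G hA)) hB

theorem formInv_mem_G {A : M₆} (hA : A ∈ G) : formInv A ∈ G := by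
  simpa using formInv_mul_mem_G hA one_mem_G

theorem formInv_formInv (A : M₆) : formInv (formInv A) = A := by
  simp only [formInv, Matrix.transpose_mul, Matrix.transpose_transpose, h_transpose]
  calc h * (h * (A * h)) * h = h * h * A * (h * h) := by simp only [Matrix.mul_assoc]
    _ = A := by rw [h_mul_h, Matrix.one_mul, Matrix.mul_one]

theorem mul_mem_G {A B : M₆} (hA : A ∈ G) (hB : B ∈ G) : A * B ∈ G := by
  simpa only [formInv_formInv] using formInv_mul_mem_G (formInv_mem_G hA) hB

end Group

/-! ### The Lie algebra of `O(4,2)` -/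

section LieAlgebra

/-- The Lie algebra of `O(4,2)`. -/
def IsInfinitesimal (X : M₆) : Prop := X.transpose * h + h * X = 0

/-- The defining matrix is symmetric, which gives 21 relations and leaves 15 free entries; the
others are written in terms of these. -/
theorem IsInfinitesimal.apply {X : M₆} (hX : IsInfinitesimal X) :
    X 5 0 = 0 ∧ X 4 1 = 0 ∧ X 2 2 = 0 ∧ X 3 3 = 0 ∧ X 1 4 = 0 ∧ X 0 5 = 0 ∧
    X 5 1 = -X 4 0 ∧ X 5 2 = X 2 0 ∧ X 5 3 = X 3 0 ∧ X 5 4 = -X 1 0 ∧ X 5 5 = -X 0 0 ∧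
    X 4 2 = X 2 1 ∧ X 4 3 = X 3 1 ∧ X 4 4 = -X 1 1 ∧ X 4 5 = -X 0 1 ∧
    X 2 3 = -X 3 2 ∧ X 1 2 = X 2 4 ∧ X 0 2 = X 2 5 ∧ X 1 3 = X 3 4 ∧ X 0 3 = X 3 5 ∧
    X 1 5 = -X 0 4 := by
  have e : ∀ i j, (X.transpose * h + h * X) i j = 0 := fun i j => by rw [hX]; rfl
  simp only [Matrix.add_apply, Matrix.mul_apply, Matrix.transpose_apply, Fin.sum_univ_six] at e
  have e00 := e 0 0; have e11 := e 1 1; have e22 := e 2 2; have e33 := e 3 3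
  have e44 := e 4 4; have e55 := e 5 5; have e01 := e 0 1; have e02 := e 0 2
  have e03 := e 0 3; have e04 := e 0 4; have e05 := e 0 5; have e12 := e 1 2
  have e13 := e 1 3; have e14 := e 1 4; have e15 := e 1 5; have e23 := e 2 3
  have e24 := e 2 4; have e25 := e 2 5; have e34 := e 3 4; have e35 := e 3 5
  have e45 := e 4 5
  simp [h] at e00 e11 e22 e33 e44 e55 e01 e02 e03 e04 e05 e12 e13 e14 e15 e23 e24 e25 e34 e35 e45
  refine ⟨?_, ?_, ?_, ?_, ?_, ?_, ?_, ?_, ?_, ?_, ?_, ?_, ?_, ?_, ?_, ?_, ?_, ?_, ?_, ?_, ?_⟩ <;>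
    linarith

theorem isInfinitesimal_of_hasDerivAt {A X : ℝ → M₆} {I : Set ℝ} (hI : IsOpen I)
    (hA : ∀ t ∈ I, A t ∈ O42) {t : ℝ} (ht : t ∈ I) (hd : HasDerivAt A (A t * X t) t) :
    IsInfinitesimal (X t) := by
  have h1 := hasDerivAt_matrix_mul (hasDerivAt_transpose hd) (hasDerivAt_const_mul h hd)
  have h2 : HasDerivAt (fun r => (A r).transpose * (h * A r)) 0 t := by
    apply hasDerivAt_matrix.2
    intro i j
    refine (hasDerivAt_const t (h i j)).congr_of_eventuallyEq ?_
    filter_upwards [hI.mem_nhds ht] with r hr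
    have : (A r).transpose * h * A r = h := hA r hr
    rw [← Matrix.mul_assoc, this]
  have h3 := hasDerivAt_matrix_unique h1 h2
  have h4 : (A t).transpose * h * A t = h := hA t ht
  calc (X t).transpose * h + h * X t
      = (X t).transpose * ((A t).transpose * h * A t) + ((A t).transpose * h * A t) * X t := by
        rw [h4]
    _ = (A t * X t).transpose * (h * A t) + (A t).transpose * (h * (A t * X t)) := by
        simp only [Matrix.transpose_mul, Matrix.mul_assoc]
    _ = 0 := h3

theorem IsInfinitesimal.h_mul_transpose {X : M₆} (hX : IsInfinitesimal X) :
    h * X.transpose = -(X * h) := by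
  have h3 : h * (X.transpose * h + h * X) * h = 0 := by
    rw [show X.transpose * h + h * X = 0 from hX]; simp
  have h4 : h * (X.transpose * h + h * X) * h
      = h * X.transpose * (h * h) + (h * h) * X * h := by
    simp only [Matrix.mul_add, Matrix.add_mul, Matrix.mul_assoc]
  rw [h4, h_mul_h, Matrix.mul_one, Matrix.one_mul] at h3
  exact eq_neg_of_add_eq_zero_left h3

/-- With `X` on the right of `F`, the product `F h Fᵀ` has derivative `F (X h + h Xᵀ) Fᵀ = 0`. This
is why the criterion `A h Aᵀ = h` is used instead of the defining one. -/
theorem mem_O42_of_hasDerivAt {F X : ℝ → M₆} {J : Set ℝ} (hJ : IsOpen J) (hJc : IsPreconnected J)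
    {t₀ : ℝ} (ht₀ : t₀ ∈ J) (hF₀ : F t₀ ∈ O42) (hF : ∀ t ∈ J, HasDerivAt F (F t * X t) t)
    (hX : ∀ t ∈ J, IsInfinitesimal (X t)) : ∀ t ∈ J, F t ∈ O42 := by
  intro t ht
  have hd : ∀ r ∈ J, HasDerivAt (fun r => F r * (h * (F r).transpose)) 0 r := by
    intro r hr
    convert! hasDerivAt_matrix_mul (hF r hr)
      (hasDerivAt_const_mul h (hasDerivAt_transpose (hF r hr))) using 1
    rw [Matrix.transpose_mul, ← Matrix.mul_assoc h, (hX r hr).h_mul_transpose]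
    simp only [Matrix.mul_assoc, Matrix.neg_mul, Matrix.mul_neg, add_neg_cancel]
  have h1 := eqOn_of_hasDerivAt_zero hJ hJc hd ht ht₀
  apply mem_O42_of_mul
  rw [Matrix.mul_assoc]
  refine h1.trans ?_
  rw [← Matrix.mul_assoc]
  exact mul_h_mul_transpose hF₀

end LieAlgebra

/-! ### Change of frame -/

section ChangeOfFrame

/-- This is `(A⁻¹)' = -X A⁻¹`. Writing the inverse as `h Aᵀ h` makes it linear in `A`, so no
differentiation of inverses is needed. -/
theorem hasDerivAt_formInv_mul {A B X : ℝ → M₆} {B' : M₆} {t : ℝ} (hX : IsInfinitesimal (X t))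
    (hA : HasDerivAt A (A t * X t) t) (hB : HasDerivAt B B' t) :
    HasDerivAt (fun r => formInv (A r) * B r)
      (formInv (A t) * B' - X t * (formInv (A t) * B t)) t := by
  have h1 := hasDerivAt_const_mul h
    (hasDerivAt_matrix_mul (hasDerivAt_transpose hA) (hasDerivAt_const_mul h hB))
  convert! h1 using 1
  · ext1 r
    simp only [formInv, Matrix.mul_assoc]
  · rw [Matrix.mul_add, Matrix.transpose_mul, Matrix.mul_assoc (X t).transpose, ← Matrix.mul_assoc h,
      hX.h_mul_transpose, add_comm, sub_eq_add_neg]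
    simp only [formInv, Matrix.mul_assoc, Matrix.neg_mul]

/-- The null plane spanned by the first two columns of a frame. -/
def planeOf (A : M₆) : Submodule ℝ (Fin 6 → ℝ) := Submodule.span ℝ {A.col 0, A.col 1}

theorem col_mem_planeOf {A : M₆} {j : Fin 6} (hj : j = 0 ∨ j = 1) : A.col j ∈ planeOf A := by
  rcases hj with rfl | rfl <;> exact Submodule.subset_span (by simp)

theorem formInv_mul_apply_eq_zero {A B : M₆} (hA : A ∈ O42) {i j : Fin 6}
    (hmem : B.col j ∈ planeOf A) (hi : 2 ≤ i) : (formInv A * B) i j = 0 := by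
  obtain ⟨a, b, hab⟩ := Submodule.mem_span_pair.1 hmem
  have hB : ∀ l, B l j = a * A l 0 + b * A l 1 := fun l => by
    have := congrFun hab l
    simpa using this.symm
  have h1 : ∀ m, ∑ l, formInv A i l * A l m = (1 : M₆) i m := fun m => by
    rw [← formInv_mul hA, Matrix.mul_apply]
  calc (formInv A * B) i j = a * ∑ l, formInv A i l * A l 0 + b * ∑ l, formInv A i l * A l 1 := by
        rw [Matrix.mul_apply, Finset.mul_sum, Finset.mul_sum, ← Finset.sum_add_distrib]
        exact Finset.sum_congr rfl fun l _ => by rw [hB]; ring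
    _ = 0 := by
        rw [h1, h1, Matrix.one_apply_ne, Matrix.one_apply_ne]
        · simp
        · rintro rfl; revert hi; decide
        · rintro rfl; revert hi; decide

end ChangeOfFrame

/-! ### Changes of frame that preserve the plane of `e₀, e₁` -/

section Stabilizer

/-- `k` maps the plane spanned by `e₀, e₁` into itself. -/
def PreservesPlane (k : M₆) : Prop := ∀ i j : Fin 6, 2 ≤ i → (j = 0 ∨ j = 1) → k i j = 0

/-- Besides the plane itself, `k` preserves its orthogonal complement, the span of `e₀, …, e₃`; this
gives the four further zeros. -/
theorem PreservesPlane.apply {k : M₆} (hk : PreservesPlane k) (hkO : k ∈ O42) :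
    k 0 0 * k 1 1 - k 0 1 * k 1 0 ≠ 0 ∧
    k 2 0 = 0 ∧ k 2 1 = 0 ∧ k 3 0 = 0 ∧ k 3 1 = 0 ∧ k 4 0 = 0 ∧ k 4 1 = 0 ∧ k 5 0 = 0 ∧
    k 5 1 = 0 ∧ k 4 2 = 0 ∧ k 4 3 = 0 ∧ k 5 2 = 0 ∧ k 5 3 = 0 := by
  have k20 := hk 2 0 (by decide) (by simp)
  have k21 := hk 2 1 (by decide) (by simp)
  have k30 := hk 3 0 (by decide) (by simp)
  have k31 := hk 3 1 (by decide) (by simp)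
  have k40 := hk 4 0 (by decide) (by simp)
  have k41 := hk 4 1 (by decide) (by simp)
  have k50 := hk 5 0 (by decide) (by simp)
  have k51 := hk 5 1 (by decide) (by simp)
  have e02 := O42_apply hkO 0 2
  have e03 := O42_apply hkO 0 3
  have e04 := O42_apply hkO 0 4
  have e05 := O42_apply hkO 0 5
  have e12 := O42_apply hkO 1 2
  have e13 := O42_apply hkO 1 3
  have e14 := O42_apply hkO 1 4
  have e15 := O42_apply hkO 1 5
  simp only [k20, k21, k30, k31, k40, k41, k50, k51] at e02 e03 e04 e05 e12 e13 e14 e15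
  simp [h] at e02 e03 e04 e05 e12 e13 e14 e15
  -- The two diagonal blocks at the corners are dual under the form, so their determinants multiply
  -- to 1. The remaining zeros then follow by Cramer's rule.
  have hD : (k 0 0 * k 1 1 - k 0 1 * k 1 0) * (k 4 4 * k 5 5 - k 4 5 * k 5 4) = 1 := by
    linear_combination -(k 0 1 * k 5 4 + k 1 1 * k 4 4) * e05
      + (k 0 1 * k 5 5 + k 1 1 * k 4 5) * e04 - e14
  have hD0 : k 0 0 * k 1 1 - k 0 1 * k 1 0 ≠ 0 := left_ne_zero_of_mul_eq_one hD
  refine ⟨hD0, k20, k21, k30, k31, k40, k41, k50, k51, ?_, ?_, ?_, ?_⟩ <;>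
    apply (mul_eq_zero_iff_left hD0).1
  · linear_combination k 0 1 * e02 - k 0 0 * e12
  · linear_combination k 0 1 * e03 - k 0 0 * e13
  · linear_combination -k 1 1 * e02 + k 1 0 * e12
  · linear_combination -k 1 1 * e03 + k 1 0 * e13

/-- A linear relation between entries of `k` valid on an open set may be differentiated; `k' = k Y -
X k` turns the result into a new algebraic relation. The products are expanded so that known entries
can be substituted. -/
theorem derivative_apply {k X Y : ℝ → M₆} {I : Set ℝ} (hI : IsOpen I)
    (hk : ∀ t ∈ I, HasDerivAt k (k t * Y t - X t * k t) t) {i j i' j' : Fin 6} {c : ℝ}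
    (heq : ∀ t ∈ I, k t i j = c * k t i' j') {t : ℝ} (ht : t ∈ I) :
    (k t i 0 * Y t 0 j + k t i 1 * Y t 1 j + k t i 2 * Y t 2 j + k t i 3 * Y t 3 j
      + k t i 4 * Y t 4 j + k t i 5 * Y t 5 j)
      - (X t i 0 * k t 0 j + X t i 1 * k t 1 j + X t i 2 * k t 2 j + X t i 3 * k t 3 j
      + X t i 4 * k t 4 j + X t i 5 * k t 5 j) =
    c * ((k t i' 0 * Y t 0 j' + k t i' 1 * Y t 1 j' + k t i' 2 * Y t 2 j' + k t i' 3 * Y t 3 j'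
      + k t i' 4 * Y t 4 j' + k t i' 5 * Y t 5 j')
      - (X t i' 0 * k t 0 j' + X t i' 1 * k t 1 j' + X t i' 2 * k t 2 j' + X t i' 3 * k t 3 j'
      + X t i' 4 * k t 4 j' + X t i' 5 * k t 5 j')) := by
  have h1 := hasDerivAt_matrix.1 (hk t ht) i j
  have h2 := (hasDerivAt_matrix.1 (hk t ht) i' j').const_mul c
  have h3 : (fun r => k r i j) =ᶠ[𝓝 t] fun r => c * k r i' j' := by
    filter_upwards [hI.mem_nhds ht] with r hr using heq r hr
  have h4 := h1.unique (h2.congr_of_eventuallyEq h3)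
  simpa only [Matrix.sub_apply, Matrix.mul_apply, Fin.sum_univ_six] using h4

theorem derivative_apply_of_eq_zero {k X Y : ℝ → M₆} {I : Set ℝ} (hI : IsOpen I)
    (hk : ∀ t ∈ I, HasDerivAt k (k t * Y t - X t * k t) t) {i j : Fin 6}
    (heq : ∀ t ∈ I, k t i j = 0) {t : ℝ} (ht : t ∈ I) :
    k t i 0 * Y t 0 j + k t i 1 * Y t 1 j + k t i 2 * Y t 2 j + k t i 3 * Y t 3 j
      + k t i 4 * Y t 4 j + k t i 5 * Y t 5 j
      = X t i 0 * k t 0 j + X t i 1 * k t 1 j + X t i 2 * k t 2 j + X t i 3 * k t 3 j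
      + X t i 4 * k t 4 j + X t i 5 * k t 5 j := by
  have := derivative_apply hI hk (i' := i) (j' := j) (c := 0) (by simpa using heq) ht
  rw [zero_mul] at this
  exact sub_eq_zero.1 this

/-- Transversality does not depend on the frame. -/
theorem contact_ne_zero {k X Y : ℝ → M₆} {I : Set ℝ} (hI : IsOpen I)
    (hk : ∀ t ∈ I, HasDerivAt k (k t * Y t - X t * k t) t)
    (hkO : ∀ t ∈ I, k t ∈ O42) (hkP : ∀ t ∈ I, PreservesPlane (k t)) {t : ℝ} (ht : t ∈ I)
    (hX : IsInfinitesimal (X t)) (hY : IsInfinitesimal (Y t))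
    (hX21 : X t 2 1 = 0) (hX31 : X t 3 1 = 0) (hX40 : X t 4 0 ≠ 0) : Y t 4 0 ≠ 0 := by
  intro hY40
  have hz := fun r hr => (hkP r hr).apply (hkO r hr)
  have e40 := derivative_apply_of_eq_zero hI hk (i := 4) (j := 0) (fun r hr => by simp [hz r hr]) ht
  have e41 := derivative_apply_of_eq_zero hI hk (i := 4) (j := 1) (fun r hr => by simp [hz r hr]) ht
  obtain ⟨hD, z⟩ := hz t ht
  simp [z, hX.apply, hY.apply, hX21, hX31, hX40, hY40] at e40 e41
  simp [e40, e41] at hD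

/-- The components of the Maurer–Cartan form that second order frames normalize. -/
structure IsSecondOrderForm (X : M₆) : Prop where
  infinitesimal : IsInfinitesimal X
  pos : 0 < X 4 0
  h20 : X 2 0 = 0
  h21 : X 2 1 = 0
  h30 : X 3 0 = 0
  h31 : X 3 1 = 0
  h24 : X 2 4 = X 4 0
  h25 : X 2 5 = 0
  h34 : X 3 4 = 0
  h35 : X 3 5 = X 4 0

theorem second_order_relations {k X Y : ℝ → M₆} {I : Set ℝ} (hI : IsOpen I)
    (hk : ∀ t ∈ I, HasDerivAt k (k t * Y t - X t * k t) t)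
    (hkO : ∀ t ∈ I, k t ∈ O42) (hkP : ∀ t ∈ I, PreservesPlane (k t))
    (hX : ∀ t ∈ I, IsSecondOrderForm (X t)) (hY : ∀ t ∈ I, IsSecondOrderForm (Y t)) :
    ∀ t ∈ I, X t 4 0 = Y t 4 0 ∧
      k t 0 2 = 0 ∧ k t 0 3 = 0 ∧ k t 1 2 = 0 ∧ k t 1 3 = 0 ∧
      k t 2 4 = 0 ∧ k t 2 5 = 0 ∧ k t 3 4 = 0 ∧ k t 3 5 = 0 ∧
      k t 1 1 = k t 0 0 ∧ k t 2 2 = k t 0 0 ∧ k t 3 3 = k t 0 0 ∧ k t 4 4 = k t 0 0 ∧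
      k t 5 5 = k t 0 0 ∧ k t 1 0 = -k t 0 1 ∧ k t 2 3 = -k t 0 1 ∧ k t 3 2 = k t 0 1 ∧
      k t 4 5 = -k t 0 1 ∧ k t 5 4 = k t 0 1 := by
  have hz := fun r hr => (hkP r hr).apply (hkO r hr)
  -- Proved on all of `I`, since these zeros are themselves differentiated in the next round.
  have hoff : ∀ t ∈ I, k t 0 2 = 0 ∧ k t 0 3 = 0 ∧ k t 1 2 = 0 ∧ k t 1 3 = 0 ∧
      k t 2 4 = 0 ∧ k t 2 5 = 0 ∧ k t 3 4 = 0 ∧ k t 3 5 = 0 := by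
    intro t ht
    obtain ⟨hXi, hXp, hX20, hX21, hX30, hX31, hX24, hX25, hX34, hX35⟩ := hX t ht
    obtain ⟨hYi, hYp, hY20, hY21, hY30, hY31, hY24, hY25, hY34, hY35⟩ := hY t ht
    have e := fun i j hij => derivative_apply_of_eq_zero hI hk (i := i) (j := j) hij ht
    have e20 := e 2 0 (fun r hr => by simp [hz r hr])
    have e21 := e 2 1 (fun r hr => by simp [hz r hr])
    have e30 := e 3 0 (fun r hr => by simp [hz r hr])
    have e31 := e 3 1 (fun r hr => by simp [hz r hr])
    have e42 := e 4 2 (fun r hr => by simp [hz r hr])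
    have e43 := e 4 3 (fun r hr => by simp [hz r hr])
    have e52 := e 5 2 (fun r hr => by simp [hz r hr])
    have e53 := e 5 3 (fun r hr => by simp [hz r hr])
    obtain ⟨-, z⟩ := hz t ht
    simp [z, hXi.apply, hYi.apply, hX20, hX21, hX30, hX31, hY20, hY21, hY30, hY31, hXp.ne',
      hYp.ne'] at e20 e21 e30 e31 e42 e43 e52 e53
    exact ⟨e42, e43, e52, e53, e20, e21, e30, e31⟩
  intro t ht
  obtain ⟨hXi, hXp, hX20, hX21, hX30, hX31, hX24, hX25, hX34, hX35⟩ := hX t ht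
  obtain ⟨hYi, hYp, hY20, hY21, hY30, hY31, hY24, hY25, hY34, hY35⟩ := hY t ht
  have e := fun i j hij => derivative_apply_of_eq_zero hI hk (i := i) (j := j) hij ht
  have e02 := e 0 2 (fun r hr => by simp [hoff r hr])
  have e03 := e 0 3 (fun r hr => by simp [hoff r hr])
  have e12 := e 1 2 (fun r hr => by simp [hoff r hr])
  have e13 := e 1 3 (fun r hr => by simp [hoff r hr])
  have e24 := e 2 4 (fun r hr => by simp [hoff r hr])
  have e25 := e 2 5 (fun r hr => by simp [hoff r hr])
  have e34 := e 3 4 (fun r hr => by simp [hoff r hr])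
  have e35 := e 3 5 (fun r hr => by simp [hoff r hr])
  have e40 := e 4 0 (fun r hr => by simp [hz r hr])
  have e41 := e 4 1 (fun r hr => by simp [hz r hr])
  have e50 := e 5 0 (fun r hr => by simp [hz r hr])
  have e51 := e 5 1 (fun r hr => by simp [hz r hr])
  obtain ⟨hD, z⟩ := hz t ht
  have o := hoff t ht
  simp [z, o, hXi.apply, hYi.apply, hX20, hX21, hX30, hX31, hY20, hY21, hY30, hY31, hX24, hX25,
    hX34, hX35, hY24, hY25, hY34, hY35, neg_eq_iff_eq_neg] at e02 e03 e12 e13 e24 e25 e34 e35 e40 e41 e50 e51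
  set a := X t 4 0 with ha
  set b := Y t 4 0 with hb
  have hab : a = b := by
    -- The relations close into cycles of length six, each step multiplying an entry by `a / b`. A
    -- nonzero entry forces `a ^ 6 = b ^ 6`, and both numbers are positive. One cycle passes through
    -- `k 0 0`, the other through `k 0 1`; these are not both zero as the block is invertible.
    have key : ∀ x0 x1 x2 x3 x4 x5 : ℝ, x0 ≠ 0 → x1 * b = a * x0 → x2 * b = a * x1 →
        x3 * b = a * x2 → x4 * b = a * x3 → x5 * b = a * x4 → x0 * b = a * x5 → a = b := by
      intro x0 x1 x2 x3 x4 x5 h0 h1 h2 h3 h4 h5 h6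
      have : x0 * b ^ 6 = x0 * a ^ 6 := by
        linear_combination b ^ 5 * h6 + a * b ^ 4 * h5 + a ^ 2 * b ^ 3 * h4 + a ^ 3 * b ^ 2 * h3
          + a ^ 4 * b * h2 + a ^ 5 * h1
      have h7 := mul_left_cancel₀ h0 this
      exact ((pow_left_inj₀ hYp.le hXp.le (by norm_num)).1 h7).symm
    by_cases h0 : k t 0 0 = 0
    · have h01 : k t 0 1 ≠ 0 := by
        rintro h01
        apply hD
        rw [h0, h01]; ring
      exact key _ (-k t 4 5) (-k t 2 3) (-k t 1 0) (k t 5 4) (k t 3 2) h01 (by linarith)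
        (by linarith) (by linarith) (by linarith) (by linarith) e02
    · exact key _ _ _ _ _ _ h0 e40 e24 e12 e51 e35 e03
  rw [← hab] at e02 e03 e12 e13 e24 e25 e34 e35 e40 e41 e50 e51
  have ha0 : a ≠ 0 := hXp.ne'
  have c : ∀ x y, x * a = a * y → x = y := fun x y hxy =>
    mul_right_cancel₀ ha0 (hxy.trans (mul_comm a y))
  refine ⟨hab, o.1, o.2.1, o.2.2.1, o.2.2.2.1, o.2.2.2.2.1, o.2.2.2.2.2.1, o.2.2.2.2.2.2.1,
    o.2.2.2.2.2.2.2, ?_⟩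
  have r44 := c _ _ e40
  have r22 := c _ _ e24
  have r11 := c _ _ e12
  have r55 := c _ _ e51
  have r33 := c _ _ e35
  have r45 := c (k t 4 5) (-k t 0 1) (by linarith)
  have r23 := c _ _ e25
  have r10 := c _ _ e13
  have r01 := c _ _ e02
  refine ⟨?_, ?_, ?_, ?_, ?_, ?_, ?_, ?_, r45, ?_⟩ <;> linarith [c _ _ e34]

/-- The frame of a curve with `κ₁ ≠ 0` is determined up to sign by the planes and the
Maurer–Cartan form. -/
theorem eq_smul_one {k X : ℝ → M₆} {I : Set ℝ} (hI : IsOpen I)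
    (hk : ∀ t ∈ I, HasDerivAt k (k t * X t - X t * k t) t)
    (hkO : ∀ t ∈ I, k t ∈ O42) (hkP : ∀ t ∈ I, PreservesPlane (k t))
    (hX : ∀ t ∈ I, IsSecondOrderForm (X t))
    (h01 : ∀ t ∈ I, X t 0 1 = -X t 1 0) (h11 : ∀ t ∈ I, X t 1 1 = -X t 0 0)
    (h00 : ∀ t ∈ I, X t 0 0 ≠ 0) {t : ℝ} (ht : t ∈ I) : k t = k t 0 0 • (1 : M₆) := by
  have hr := second_order_relations hI hk hkO hkP hX hX
  obtain ⟨-, z⟩ := (hkP t ht).apply (hkO t ht)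
  obtain ⟨hXi, hXp, hX20, hX21, hX30, hX31, hX24, hX25, hX34, hX35⟩ := hX t ht
  have e := fun i j i' j' c hij => derivative_apply hI hk (i := i) (j := j) (i' := i')
    (j' := j') (c := c) hij ht
  -- The block of `k` in rows and columns 2, 3 is a scaled rotation and commutes with that of `X`,
  -- so it is constant, and so are the entries tied to it. Entries `(0,1)` and `(4,5)` then give `2
  -- X₀₀ k₀₁ + X₄₀ k₀₅ = 0` and `2 X₀₀ k₀₁ - X₄₀ k₀₅ = 0`, hence `k₀₁ = 0`. The rest kill the upper
  -- right corner.
  have e00 := e 0 0 2 2 1 (fun r hr' => by simp [hr r hr'])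
  have e01 := e 0 1 2 3 (-1) (fun r hr' => by simp [hr r hr'])
  have e10 := e 1 0 2 3 1 (fun r hr' => by simp [hr r hr'])
  have e11 := e 1 1 2 2 1 (fun r hr' => by simp [hr r hr'])
  have e45 := e 4 5 2 3 1 (fun r hr' => by simp [hr r hr'])
  obtain ⟨-, o⟩ := hr t ht
  simp only [z, o, hXi.apply, hX20, hX21, hX30, hX31, hX24, hX25, hX34, hX35, h01 t ht, h11 t ht]
    at e00 e01 e10 e11 e45
  have hk01 : k t 0 1 = 0 := by
    apply (mul_eq_zero_iff_left (h00 t ht)).1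
    linarith
  have hd : ∀ x, X t 4 0 * x = 0 → x = 0 := fun x hx => (mul_eq_zero_iff_left hXp.ne').1 hx
  rw [hk01] at e00 e01 e10 e11
  have k04 := hd (k t 0 4) (by linarith)
  have k05 := hd (k t 0 5) (by linarith)
  have k14 := hd (k t 1 4) (by linarith)
  have k15 := hd (k t 1 5) (by linarith)
  ext i j
  fin_cases i <;> fin_cases j <;> simp [z, o, hk01, k04, k05, k14, k15]

end Stabilizer

/-! ### Frame fields, their planes and their Maurer–Cartan forms -/

section Frames

theorem hasDerivAt_changeOfFrame {A B X Y : ℝ → M₆} {I : Set ℝ}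
    (hX : ∀ t ∈ I, IsInfinitesimal (X t))
    (hA : ∀ t ∈ I, HasDerivAt A (A t * X t) t) (hB : ∀ t ∈ I, HasDerivAt B (B t * Y t) t) :
    ∀ t ∈ I, HasDerivAt (fun r => formInv (A r) * B r)
      (formInv (A t) * B t * Y t - X t * (formInv (A t) * B t)) t := by
  intro t ht
  rw [Matrix.mul_assoc]
  exact hasDerivAt_formInv_mul (hX t ht) (hA t ht) (hB t ht)

theorem preservesPlane_formInv_mul {A B : M₆} (hA : A ∈ O42) (hAB : planeOf A = planeOf B) :
    PreservesPlane (formInv A * B) :=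
  fun _ _ hi hj => formInv_mul_apply_eq_zero hA (hAB ▸ col_mem_planeOf hj) hi

theorem planeOf_mul (c A : M₆) : planeOf (c * A) = (planeOf A).map (Matrix.toLin' c) := by
  rw [planeOf, planeOf, Submodule.map_span, image_pair]
  rfl

theorem planeOf_smul {x : ℝ} (hx : x ≠ 0) (A : M₆) : planeOf (x • A) = planeOf A := by
  have h1 : ∀ j, (x • A).col j = x • A.col j := fun j => rfl
  apply le_antisymm
  · rw [planeOf, Submodule.span_le]
    rintro _ (rfl | rfl)
    · exact (planeOf A).smul_mem x (col_mem_planeOf (by simp))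
    · exact (planeOf A).smul_mem x (col_mem_planeOf (by simp))
  · rw [planeOf, Submodule.span_le]
    have h2 : ∀ j, A.col j = x⁻¹ • (x • A).col j := fun j => by
      rw [h1, smul_smul, inv_mul_cancel₀ hx, one_smul]
    rintro _ (rfl | rfl)
    · rw [h2]; exact (planeOf (x • A)).smul_mem _ (col_mem_planeOf (by simp))
    · rw [h2]; exact (planeOf (x • A)).smul_mem _ (col_mem_planeOf (by simp))

theorem finrank_planeOf {A : M₆} (hA : A ∈ O42) : Module.finrank ℝ (planeOf A) = 2 := by
  have hu : IsUnit A := IsUnit.of_mul_eq_one _ (mul_formInv hA)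
  have hli := Matrix.linearIndependent_cols_iff_isUnit.2 hu
  have h2 : LinearIndependent ℝ (fun i : Fin 2 => A.col (Fin.castLE (by norm_num) i)) :=
    hli.comp _ (Fin.castLE_injective _)
  have h3 := finrank_span_eq_card h2
  rw [Fintype.card_fin] at h3
  have h4 : range (fun i : Fin 2 => A.col (Fin.castLE (by norm_num) i)) = {A.col 0, A.col 1} := by
    ext v
    simp [Fin.exists_fin_two, eq_comm]
  rw [← h3, planeOf, h4]

theorem lieForm_col {A : M₆} (hA : A ∈ O42) (i j : Fin 6) :
    lieForm (A.col i) (A.col j) = h i j := by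
  rw [← O42_apply hA i j, lieForm_eq]
  rfl

theorem lieForm_planeOf {A : M₆} (hA : A ∈ O42) :
    ∀ x ∈ planeOf A, ∀ y ∈ planeOf A, lieForm x y = 0 := by
  intro x hx y hy
  obtain ⟨a, b, rfl⟩ := Submodule.mem_span_pair.1 hx
  obtain ⟨c, d, rfl⟩ := Submodule.mem_span_pair.1 hy
  have e00 := lieForm_col hA 0 0
  have e01 := lieForm_col hA 0 1
  have e11 := lieForm_col hA 1 1
  simp [lieForm_eq, h] at e00 e01 e11 ⊢
  linear_combination a * c * e00 + (a * d + b * c) * e01 + b * d * e11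

/-- The null plane spanned by the first two columns of an element of `O(4,2)`. -/
def nullPlaneOf {A : M₆} (hA : A ∈ O42) : NullPlane :=
  ⟨planeOf A, finrank_planeOf hA, lieForm_planeOf hA⟩

theorem theta_eq_of_hasDerivAt {A : ℝ → M₆} {X : M₆} {t : ℝ} (hA : A t ∈ O42)
    (hd : HasDerivAt A (A t * X) t) : theta A t = X := by
  have : Matrix.of (fun i j => deriv (fun r => A r i j) t) = A t * X := by
    ext i j
    exact (hasDerivAt_matrix.1 hd i j).deriv
  rw [theta, this, inv_eq_formInv hA, ← Matrix.mul_assoc, formInv_mul hA, Matrix.one_mul]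

variable {γ : ℝ → NullPlane} {I : Set ℝ} {A : ℝ → M₆}

theorem IsLieFrame.mem_O42 (hA : IsLieFrame γ I A) {t : ℝ} (ht : t ∈ I) : A t ∈ O42 :=
  mem_O42_of_mem_G (hA.mem_G t ht)

theorem IsLieFrame.hasDerivAt (hA : IsLieFrame γ I A) {t : ℝ} (ht : t ∈ I) :
    HasDerivAt A (A t * theta A t) t := by
  rw [theta, inv_eq_formInv (hA.mem_O42 ht), ← Matrix.mul_assoc, mul_formInv (hA.mem_O42 ht),
    Matrix.one_mul]
  refine hasDerivAt_matrix.2 fun i j => ?_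
  exact (((hA.smooth i j).contDiffAt (hA.isOpen.mem_nhds ht)).differentiableAt
    (by simp)).hasDerivAt

theorem IsLieFrame.isInfinitesimal (hA : IsLieFrame γ I A) {t : ℝ} (ht : t ∈ I) :
    IsInfinitesimal (theta A t) :=
  isInfinitesimal_of_hasDerivAt hA.isOpen (fun _ hr => hA.mem_O42 hr) ht (hA.hasDerivAt ht)

theorem IsSecondOrderFrame.isSecondOrderForm (hA : IsSecondOrderFrame γ I A) {t : ℝ}
    (ht : t ∈ I) : IsSecondOrderForm (theta A t) := by
  have hpos := hA.pos t ht
  have hP := hA.P_eq t ht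
  have e00 := congrFun (congrFun hP 0) 0
  have e01 := congrFun (congrFun hP 0) 1
  have e10 := congrFun (congrFun hP 1) 0
  have e11 := congrFun (congrFun hP 1) 1
  simp [P, hpos.ne'] at e00 e01 e10 e11
  exact ⟨hA.isInfinitesimal ht, hpos, hA.h20 t ht, hA.h21 t ht, hA.h30 t ht, hA.h31 t ht,
    ((inv_mul_eq_one₀ hpos.ne').1 e00).symm, e01, e10, ((inv_mul_eq_one₀ hpos.ne').1 e11).symm⟩

/-- The Lie arclength element does not depend on the second order frame. -/
theorem theta_four_zero_eq {A B : ℝ → M₆} {I₁ I₂ : Set ℝ} (hA : IsSecondOrderFrame γ I₁ A)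
    (hB : IsSecondOrderFrame γ I₂ B) {t : ℝ} (h₁ : t ∈ I₁) (h₂ : t ∈ I₂) :
    theta A t 4 0 = theta B t 4 0 := by
  have hAO := fun r (hr : r ∈ I₁ ∩ I₂) => hA.mem_O42 hr.1
  exact (second_order_relations (hA.isOpen.inter hB.isOpen)
    (hasDerivAt_changeOfFrame (fun r hr => hA.isInfinitesimal hr.1)
      (fun r hr => hA.hasDerivAt hr.1) (fun r hr => hB.hasDerivAt hr.2))
    (fun r hr => mul_mem_O42 (formInv_mem_O42 (hAO r hr)) (hB.mem_O42 hr.2))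
    (fun r hr => preservesPlane_formInv_mul (hAO r hr)
      ((hA.span_eq r hr.1).symm.trans (hB.span_eq r hr.2)))
    (fun r hr => hA.isSecondOrderForm hr.1) (fun r hr => hB.isSecondOrderForm hr.2)
    t ⟨h₁, h₂⟩).1

end Frames

/-! ### The normal form of the Maurer–Cartan matrix -/

section CurvatureForm

/-- The Maurer–Cartan form of a fourth order frame with arclength element `ρ`. -/
def curvatureForm (ρ κ₁ κ₂ κ₃ κ₄ : ℝ) : M₆ :=
  !![ρ * κ₁, -(ρ * κ₂), 0, ρ, ρ * κ₄, 0;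
     ρ * κ₂, -(ρ * κ₁), ρ, 0, 0, -(ρ * κ₄);
     0, 0, 0, -(ρ * κ₃), ρ, 0;
     0, 0, ρ * κ₃, 0, 0, ρ;
     ρ, 0, 0, 0, ρ * κ₁, ρ * κ₂;
     0, -ρ, 0, 0, -(ρ * κ₂), -(ρ * κ₁)]

variable {ρ κ₁ κ₂ κ₃ κ₄ : ℝ}

theorem isSecondOrderForm_curvatureForm (hρ : 0 < ρ) :
    IsSecondOrderForm (curvatureForm ρ κ₁ κ₂ κ₃ κ₄) where
  infinitesimal := by
    ext i j
    fin_cases i <;> fin_cases j <;>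
      simp [curvatureForm, h, Matrix.mul_apply, Fin.sum_univ_six]
  pos := by simpa [curvatureForm] using hρ
  h20 := by simp [curvatureForm]
  h21 := by simp [curvatureForm]
  h30 := by simp [curvatureForm]
  h31 := by simp [curvatureForm]
  h24 := by simp [curvatureForm]
  h25 := by simp [curvatureForm]
  h34 := by simp [curvatureForm]
  h35 := by simp [curvatureForm]

theorem eq_curvatureForm {X : M₆} (hX : IsSecondOrderForm X) (htr : X 0 0 + X 1 1 = 0)
    (hp : X 0 1 + X 1 0 = 0) (hρ : X 4 0 = ρ) (h1 : X 0 0 = κ₁ * X 4 0) (h2 : X 1 0 = κ₂ * X 4 0)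
    (h3 : X 3 2 = κ₃ * X 4 0) (h4 : X 0 4 = κ₄ * X 4 0) :
    X = curvatureForm ρ κ₁ κ₂ κ₃ κ₄ := by
  obtain ⟨hXi, -, hX20, hX21, hX30, hX31, hX24, hX25, hX34, hX35⟩ := hX
  have h11 : X 1 1 = -X 0 0 := by linarith
  have h01 : X 0 1 = -X 1 0 := by linarith
  ext i j
  fin_cases i <;> fin_cases j <;>
    simp [curvatureForm, hXi.apply, hX20, hX21, hX30, hX31, hX24, hX25, hX34, hX35, h11, h01,
      h1, h2, h3, h4, hρ, mul_comm]

end CurvatureForm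

/-! ### Uniqueness up to congruence -/

section Uniqueness

variable {J : Set ℝ} {s κ₁ κ₂ κ₃ κ₄ : ℝ → ℝ} {γ : ℝ → NullPlane}

theorem exists_frame_theta_eq_curvatureForm (hs : IsLieArclength J γ s)
    (hκ : AreLieCurvatures J γ κ₁ κ₂ κ₃ κ₄) {t : ℝ} (ht : t ∈ J) :
    ∃ (I : Set ℝ) (A : ℝ → M₆), IsOpen I ∧ IsPreconnected I ∧ t ∈ I ∧ I ⊆ J ∧
      ∀ r ∈ I, A r ∈ G ∧ (γ r).1 = planeOf (A r) ∧
        HasDerivAt A (A r * curvatureForm (deriv s r) (κ₁ r) (κ₂ r) (κ₃ r) (κ₄ r)) r := by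
  obtain ⟨I₁, A, h₁, h₁J, hA, hκA⟩ := hκ t ht
  obtain ⟨I₂, B, h₂, -, hB, hsB⟩ := hs t ht
  obtain ⟨ε, hε, hball⟩ := Metric.isOpen_iff.1 (hA.isOpen.inter hB.isOpen) t ⟨h₁, h₂⟩
  refine ⟨Metric.ball t ε, A, Metric.isOpen_ball, (convex_ball t ε).isPreconnected,
    Metric.mem_ball_self hε, fun r hr => h₁J (hball hr).1, fun r hr => ?_⟩
  have hr₁ := (hball hr).1
  have hr₂ := (hball hr).2
  refine ⟨hA.mem_G r hr₁, hA.span_eq r hr₁, ?_⟩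
  have hform := hA.isSecondOrderForm hr₁
  have hρ : theta A r 4 0 = deriv s r := by
    rw [theta_four_zero_eq hA.toIsSecondOrderFrame hB hr₁ hr₂, (hsB r hr₂).deriv]
  have hp := hA.p_eq r hr₁
  rw [p, div_eq_zero_iff, or_iff_left hform.pos.ne', div_eq_zero_iff, or_iff_left two_ne_zero] at hp
  obtain ⟨e1, e2, e3, e4⟩ := hκA r hr₁
  rw [← eq_curvatureForm hform (hA.trace_eq r hr₁) hp hρ e1 e2 e3 e4]
  exact hA.hasDerivAt hr₁

/-- Two solutions of one linear equation differ by a constant left factor: `A F⁻¹` has derivative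
zero, with `F⁻¹ = h Fᵀ h`. -/
theorem eq_const_mul_of_hasDerivAt {A F X : ℝ → M₆} {I : Set ℝ} (hI : IsOpen I)
    (hIc : IsPreconnected I) (hX : ∀ t ∈ I, IsInfinitesimal (X t))
    (hA : ∀ t ∈ I, HasDerivAt A (A t * X t) t) (hF : ∀ t ∈ I, HasDerivAt F (F t * X t) t)
    (hFO : ∀ t ∈ I, F t ∈ O42) {t : ℝ} (ht : t ∈ I) :
    ∀ r ∈ I, A r = A t * formInv (F t) * F r := by
  have hd : ∀ r ∈ I, HasDerivAt (fun r => A r * (h * (F r).transpose)) 0 r := by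
    intro r hr
    convert! hasDerivAt_matrix_mul (hA r hr)
      (hasDerivAt_const_mul h (hasDerivAt_transpose (hF r hr))) using 1
    rw [Matrix.transpose_mul, ← Matrix.mul_assoc h, (hX r hr).h_mul_transpose]
    simp only [Matrix.mul_assoc, Matrix.neg_mul, Matrix.mul_neg, add_neg_cancel]
  intro r hr
  have h1 : A r * formInv (F r) = A t * formInv (F t) := by
    have := congrArg (· * h) (eqOn_of_hasDerivAt_zero hI hIc hd hr ht)
    simpa only [formInv, Matrix.mul_assoc] using this
  rw [← h1, Matrix.mul_assoc, formInv_mul (hFO r hr), Matrix.mul_one]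

/-- Two congruent copies of the curve generated by `F` that agree on a nonempty open set agree
everywhere. -/
theorem planeOf_mul_eq_of_eqOn {F X : ℝ → M₆} {I : Set ℝ} (hI : IsOpen I)
    (hF : ∀ t ∈ I, HasDerivAt F (F t * X t) t) (hFO : ∀ t ∈ I, F t ∈ O42)
    (hX : ∀ t ∈ I, IsSecondOrderForm (X t))
    (h01 : ∀ t ∈ I, X t 0 1 = -X t 1 0) (h11 : ∀ t ∈ I, X t 1 1 = -X t 0 0)
    (h00 : ∀ t ∈ I, X t 0 0 ≠ 0) {c c' : M₆} (hc : c ∈ O42) (hc' : c' ∈ O42)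
    (heq : ∀ t ∈ I, planeOf (c * F t) = planeOf (c' * F t)) {t : ℝ} (ht : t ∈ I) (B : M₆) :
    planeOf (c * B) = planeOf (c' * B) := by
  have hcF : ∀ c : M₆, ∀ t ∈ I, HasDerivAt (fun r => c * F r) (c * F t * X t) t := by
    intro c t ht
    rw [Matrix.mul_assoc]
    exact hasDerivAt_const_mul c (hF t ht)
  have hcO := fun r hr => mul_mem_O42 hc (hFO r hr)
  have hcO' := fun r hr => mul_mem_O42 hc' (hFO r hr)
  have hkO := fun r hr => mul_mem_O42 (formInv_mem_O42 (hcO r hr)) (hcO' r hr)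
  have hkP := fun r hr => preservesPlane_formInv_mul (hcO r hr) (heq r hr)
  have key := eq_smul_one hI
    (hasDerivAt_changeOfFrame (fun r hr => (hX r hr).infinitesimal) (hcF c) (hcF c'))
    hkO hkP hX h01 h11 h00 ht
  -- The scalar cannot vanish, since `k` is invertible on the plane of `e₀, e₁`.
  have hx : (formInv (c * F t) * (c' * F t)) 0 0 ≠ 0 := by
    intro h0
    rw [h0, zero_smul] at key
    have := ((hkP t ht).apply (hkO t ht)).1
    rw [key] at this
    simp at this
  set x := (formInv (c * F t) * (c' * F t)) 0 0
  have h1 : c' * F t = x • (c * F t) := by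
    calc c' * F t = c * F t * (formInv (c * F t) * (c' * F t)) := by
          rw [← Matrix.mul_assoc, mul_formInv (hcO t ht), Matrix.one_mul]
      _ = _ := by rw [key, Matrix.mul_smul, Matrix.mul_one]
  have h2 : c' = x • c := by
    calc c' = c' * F t * formInv (F t) := by
          rw [Matrix.mul_assoc, mul_formInv (hFO t ht), Matrix.mul_one]
      _ = _ := by
        rw [h1, Matrix.smul_mul, Matrix.mul_assoc, mul_formInv (hFO t ht), Matrix.mul_one]
  rw [h2, Matrix.smul_mul, planeOf_smul hx]

theorem exists_eq_planeOf_mul (hJc : IsConnected J) (hs' : ∀ t ∈ J, 0 < deriv s t)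
    (hκ₁_ne : ∀ t ∈ J, κ₁ t ≠ 0) {F : ℝ → M₆} (hFG : ∀ t, F t ∈ G)
    (hF : ∀ t ∈ J, HasDerivAt F
      (F t * curvatureForm (deriv s t) (κ₁ t) (κ₂ t) (κ₃ t) (κ₄ t)) t)
    (hs : IsLieArclength J γ s) (hκ : AreLieCurvatures J γ κ₁ κ₂ κ₃ κ₄) :
    ∃ c ∈ G, ∀ t ∈ J, (γ t).1 = planeOf (c * F t) := by
  have hFO := fun t => mem_O42_of_mem_G (hFG t)
  have hX := fun t ht => isSecondOrderForm_curvatureForm (κ₁ := κ₁ t) (κ₂ := κ₂ t) (κ₃ := κ₃ t)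
    (κ₄ := κ₄ t) (hs' t ht)
  have hloc : ∀ t ∈ J, ∃ I, IsOpen I ∧ t ∈ I ∧ I ⊆ J ∧ ∃ c ∈ G, ∀ r ∈ I,
      (γ r).1 = planeOf (c * F r) := by
    intro t ht
    obtain ⟨I, A, hI, hIc, htI, hIJ, hA⟩ := exists_frame_theta_eq_curvatureForm hs hκ ht
    refine ⟨I, hI, htI, hIJ, A t * formInv (F t),
      mul_mem_G (hA t htI).1 (formInv_mem_G (hFG t)), fun r hr => ?_⟩
    rw [(hA r hr).2.1, eq_const_mul_of_hasDerivAt hI hIc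
      (fun r hr => (hX r (hIJ hr)).infinitesimal) (fun r hr => (hA r hr).2.2)
      (fun r hr => hF r (hIJ hr)) (fun r _ => hFO r) htI r hr]
  obtain ⟨t₀, ht₀⟩ := hJc.nonempty
  obtain ⟨I₀, hI₀, ht₀I, -, c, hc, hγc⟩ := hloc t₀ ht₀
  refine ⟨c, hc, ?_⟩
  set U := {t | ∀ᶠ r in 𝓝 t, (γ r).1 = planeOf (c * F r)} with hU
  have hUo : IsOpen U := isOpen_setOfPred_eventually_nhds
  -- `V` is the interior of the complement of `U`. A local patch of the curve that meets `U` lies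
  -- entirely in `U`, by `planeOf_mul_eq_of_eqOn`; otherwise it lies in `V`.
  set V := ⋃₀ {I | IsOpen I ∧ Disjoint U I} with hV
  have hVo : IsOpen V := isOpen_sUnion fun I hI => hI.1
  have hUV : Disjoint U V := disjoint_sUnion_right.2 fun I hI => hI.2
  have hcover : J ⊆ U ∪ V := by
    intro t ht
    obtain ⟨I, hI, htI, hIJ, c', hc', hγ'⟩ := hloc t ht
    by_cases hd : Disjoint U I
    · exact Or.inr ⟨I, ⟨hI, hd⟩, htI⟩
    · left
      obtain ⟨r, hrU, hrI⟩ := not_disjoint_iff.1 hd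
      obtain ⟨W, hW, hWo, hrW⟩ := eventually_nhds_iff.1 hrU
      have hB := planeOf_mul_eq_of_eqOn (hI.inter hWo) (fun r hr => hF r (hIJ hr.1))
        (fun r _ => hFO r) (fun r hr => hX r (hIJ hr.1)) (fun r _ => by simp [curvatureForm])
        (fun r _ => by simp [curvatureForm])
        (fun r hr => by
          simpa [curvatureForm] using ⟨(hs' r (hIJ hr.1)).ne', hκ₁_ne r (hIJ hr.1)⟩)
        (mem_O42_of_mem_G hc) (mem_O42_of_mem_G hc')
        (fun r hr => (hW r hr.2).symm.trans (hγ' r hr.1)) ⟨hrI, hrW⟩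
      filter_upwards [hI.mem_nhds htI] with x hx
      rw [hB, hγ' x hx]
  have hsub := hJc.isPreconnected.subset_left_of_subset_union hUo hVo hUV hcover
    ⟨t₀, ht₀, by filter_upwards [hI₀.mem_nhds ht₀I] with r hr using hγc r hr⟩
  exact fun t ht => (hsub ht).self_of_nhds

end Uniqueness

/-! ### Existence -/

section Existence

variable {J : Set ℝ} {s κ₁ κ₂ κ₃ κ₄ : ℝ → ℝ}

/-- Bootstrapping: if `F` is `C^n`, then `F' = F X` is `C^n`, so `F` is `C^(n+1)`. -/
theorem contDiffOn_of_hasDerivAt_mul {F X : ℝ → M₆} (hJ : IsOpen J)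
    (hF : ∀ t ∈ J, HasDerivAt F (F t * X t) t)
    (hX : ∀ i j, ContDiffOn ℝ ∞ (fun t => X t i j) J) (i j : Fin 6) :
    ContDiffOn ℝ ∞ (fun t => F t i j) J := by
  have hd : ∀ i j, ∀ t ∈ J, HasDerivAt (fun r => F r i j) (∑ l, F t i l * X t l j) t :=
    fun i j t ht => hasDerivAt_matrix.1 (hF t ht) i j
  have hn : ∀ n : ℕ, ∀ i j, ContDiffOn ℝ n (fun t => F t i j) J := by
    intro n
    induction n with
    | zero =>
      intro i j
      exact contDiffOn_zero.2 fun t ht => (hd i j t ht).continuousAt.continuousWithinAt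
    | succ n ih =>
      intro i j
      rw [Nat.cast_succ, contDiffOn_succ_iff_deriv_of_isOpen hJ]
      refine ⟨fun t ht => (hd i j t ht).differentiableAt.differentiableWithinAt, by simp, ?_⟩
      refine ContDiffOn.congr (f := fun t => ∑ l, F t i l * X t l j) ?_
        fun t ht => (hd i j t ht).deriv
      exact ContDiffOn.sum fun l _ => (ih i l).mul ((hX l j).of_le (by exact_mod_cast le_top))
  exact contDiffOn_infty.2 fun n => hn n i j

theorem contDiffOn_curvatureForm (hJ : IsOpen J) (hs : ContDiffOn ℝ ∞ s J)
    (hκ₁ : ContDiffOn ℝ ∞ κ₁ J) (hκ₂ : ContDiffOn ℝ ∞ κ₂ J)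
    (hκ₃ : ContDiffOn ℝ ∞ κ₃ J) (hκ₄ : ContDiffOn ℝ ∞ κ₄ J) (i j : Fin 6) :
    ContDiffOn ℝ ∞ (fun t => curvatureForm (deriv s t) (κ₁ t) (κ₂ t) (κ₃ t) (κ₄ t) i j) J := by
  have hρ := ((contDiffOn_infty_iff_deriv_of_isOpen hJ).1 hs).2
  fin_cases i <;> fin_cases j <;> simp [curvatureForm] <;> fun_prop

theorem exists_frame (hJ : IsOpen J) (hJc : IsConnected J) {X : ℝ → M₆}
    (hX : ∀ i j, ContDiffOn ℝ ∞ (fun t => X t i j) J) (hXi : ∀ t ∈ J, IsInfinitesimal (X t)) :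
    ∃ F : ℝ → M₆, (∀ t, F t ∈ G) ∧ ∀ t ∈ J, HasDerivAt F (F t * X t) t := by
  obtain ⟨t₀, ht₀⟩ := hJc.nonempty
  obtain ⟨F, hF₀, hF⟩ := exists_matrix_hasDerivAt_mul hJ hJc.isPreconnected ht₀
    fun i j => (hX i j).continuousOn
  have hFO := mem_O42_of_hasDerivAt hJ hJc.isPreconnected ht₀ (hF₀ ▸ one_mem_O42) hF hXi
  have hFG : ∀ t ∈ J, F t ∈ G := by
    intro t ht
    have := mul_mem_G_of_mem
      (hJc.isPreconnected.image F (continuousOn_of_hasDerivAt_matrix hF))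
      (image_subset_iff.2 hFO) one_mem_O42 ⟨t₀, ht₀, hF₀⟩ (Matrix.one_mul 1) ⟨t, ht, rfl⟩
    rwa [Matrix.one_mul] at this
  classical
  -- The value 1 off `J` keeps the frame in `G` for every real `t`, so that it defines a null plane
  -- for every `t`.
  refine ⟨fun t => if t ∈ J then F t else 1, fun t => ?_, fun t ht => ?_⟩
  · dsimp only
    split_ifs with ht
    · exact hFG t ht
    · exact one_mem_G
  · beta_reduce
    rw [if_pos ht]
    refine hasDerivAt_matrix.2 fun i j => ?_
    refine (hasDerivAt_matrix.1 (hF t ht) i j).congr_of_eventuallyEq ?_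
    filter_upwards [hJ.mem_nhds ht] with r hr
    rw [if_pos hr]

/-- Modulo the plane, the derivative of `w₀ F₀ + w₁ F₁` has `F₄` and `F₅` components `X₄₀ w₀` and
`-X₄₀ w₁`. The velocity of the curve of planes is thus injective, which gives immersion. -/
theorem eq_zero_of_deriv_mem_planeOf {F X : ℝ → M₆} {I : Set ℝ} (hI : IsOpen I)
    (hF : ∀ t ∈ I, HasDerivAt F (F t * X t) t) (hFO : ∀ t ∈ I, F t ∈ O42)
    (hX : ∀ t ∈ I, IsSecondOrderForm (X t)) {u : ℝ → Fin 6 → ℝ}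
    (hu : ∀ t ∈ I, u t ∈ planeOf (F t)) {t : ℝ} (ht : t ∈ I) (hd : DifferentiableAt ℝ u t)
    (hd' : deriv u t ∈ planeOf (F t)) : u t = 0 := by
  -- The vector is repeated in every column so that the matrix lemmas apply to it.
  let U : ℝ → M₆ := fun r => Matrix.of fun i _ => u r i
  let U' : M₆ := Matrix.of fun i _ => deriv u t i
  have hU : HasDerivAt U U' t :=
    hasDerivAt_matrix.2 fun i _ => hasDerivAt_pi.1 hd.hasDerivAt i
  have hz : ∀ r ∈ I, ∀ i, 2 ≤ i → (formInv (F r) * U r) i 0 = 0 := fun r hr i hi =>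
    formInv_mul_apply_eq_zero (hFO r hr) (B := U r) (hu r hr) hi
  have hz' : ∀ i, 2 ≤ i → (formInv (F t) * U') i 0 = 0 := fun i hi =>
    formInv_mul_apply_eq_zero (hFO t ht) (B := U') hd' hi
  obtain ⟨hXi, hXp, hX20, hX21, hX30, hX31, -⟩ := hX t ht
  have hk := hasDerivAt_matrix.1 (hasDerivAt_formInv_mul hXi (hF t ht) hU)
  have hk0 : ∀ i, 2 ≤ i → (X t * (formInv (F t) * U t)) i 0 = 0 := by
    intro i hi
    have h1 := (hk i 0).unique ((hasDerivAt_const t (0 : ℝ)).congr_of_eventuallyEq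
      (by filter_upwards [hI.mem_nhds ht] with r hr using hz r hr i hi))
    rw [Matrix.sub_apply, hz' i hi, zero_sub, neg_eq_zero] at h1
    exact h1
  have e4 := hk0 4 (by decide)
  have e5 := hk0 5 (by decide)
  have z := fun i hi => hz t ht i hi
  have z2 := z 2 (by decide); have z3 := z 3 (by decide)
  have z4 := z 4 (by decide); have z5 := z 5 (by decide)
  rw [Matrix.mul_apply, Fin.sum_univ_six] at e4 e5
  simp only [z2, z3, z4, z5, hXi.apply] at e4 e5
  have w0 : (formInv (F t) * U t) 0 0 = 0 := by simpa [hXp.ne'] using e4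
  have w1 : (formInv (F t) * U t) 1 0 = 0 := by simpa [hXp.ne'] using e5
  have hw : ∀ i, (formInv (F t) * U t) i 0 = 0 := by
    intro i
    fin_cases i
    exacts [w0, w1, z2, z3, z4, z5]
  ext i
  have h1 : (F t * (formInv (F t) * U t)) i 0 = 0 := by
    rw [Matrix.mul_apply]
    exact Finset.sum_eq_zero fun l _ => by rw [hw, mul_zero]
  rw [← Matrix.mul_assoc, mul_formInv (hFO t ht), Matrix.one_mul] at h1
  exact h1

theorem exists_curve (hJ : IsOpen J) (hs : ContDiffOn ℝ ∞ s J) (hs' : ∀ t ∈ J, 0 < deriv s t)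
    (hκ₁ : ContDiffOn ℝ ∞ κ₁ J) (hκ₂ : ContDiffOn ℝ ∞ κ₂ J)
    (hκ₃ : ContDiffOn ℝ ∞ κ₃ J) (hκ₄ : ContDiffOn ℝ ∞ κ₄ J)
    (hκ₁_ne : ∀ t ∈ J, κ₁ t ≠ 0) {F : ℝ → M₆} (hFG : ∀ t, F t ∈ G)
    (hF : ∀ t ∈ J, HasDerivAt F
      (F t * curvatureForm (deriv s t) (κ₁ t) (κ₂ t) (κ₃ t) (κ₄ t)) t) :
    ∃ γ : ℝ → NullPlane, IsGeneric J γ ∧ IsLieArclength J γ s ∧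
      AreLieCurvatures J γ κ₁ κ₂ κ₃ κ₄ := by
  have hFO := fun t => mem_O42_of_mem_G (hFG t)
  set X : ℝ → M₆ := fun t => curvatureForm (deriv s t) (κ₁ t) (κ₂ t) (κ₃ t) (κ₄ t) with hXdef
  have hX : ∀ t ∈ J, IsSecondOrderForm (X t) := fun t ht =>
    isSecondOrderForm_curvatureForm (hs' t ht)
  have hθ : ∀ t ∈ J, theta F t = X t := fun t ht => theta_eq_of_hasDerivAt (hFO t) (hF t ht)
  have hsm := contDiffOn_of_hasDerivAt_mul hJ hF
    (contDiffOn_curvatureForm hJ hs hκ₁ hκ₂ hκ₃ hκ₄)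
  let γ : ℝ → NullPlane := fun t => nullPlaneOf (hFO t)
  have hframe : IsFourthOrderFrame γ J F := by
    refine ⟨⟨⟨⟨⟨hJ, fun t _ => hFG t, hsm, fun t _ => rfl⟩, ?_, ?_, ?_, ?_, ?_⟩, ?_⟩, ?_⟩, ?_⟩ <;>
      intro t ht
    · rw [hθ t ht]; exact (hX t ht).pos
    · rw [hθ t ht]; exact (hX t ht).h20
    · rw [hθ t ht]; exact (hX t ht).h21
    · rw [hθ t ht]; exact (hX t ht).h30
    · rw [hθ t ht]; exact (hX t ht).h31
    · rw [P, hθ t ht, (hX t ht).h24, (hX t ht).h25, (hX t ht).h34, (hX t ht).h35]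
      ext i j
      fin_cases i <;> fin_cases j <;> simp [(hX t ht).pos.ne']
    · rw [hθ t ht]; simp [hXdef, curvatureForm]
    · rw [p, hθ t ht]; simp [hXdef, curvatureForm]
  have hT : IsTCurve J γ := by
    refine ⟨?_, ?_, ?_⟩
    · exact fun t ht => ⟨J, hJ, ht, subset_rfl, fun r => (F r).col 0, fun r => (F r).col 1,
        contDiffOn_pi.2 fun i => hsm i 0, contDiffOn_pi.2 fun i => hsm i 1, fun r _ => rfl⟩
    · rintro I u v hI hIJ ⟨hu, hv, huv⟩ t ht ⟨hu', hv'⟩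
      have hzero : ∀ w : ℝ → Fin 6 → ℝ, ContDiffOn ℝ ∞ w I →
          (∀ r ∈ I, w r ∈ (γ r).1) → deriv w t ∈ (γ t).1 → w t = 0 := fun w hw hwγ hw' =>
        eq_zero_of_deriv_mem_planeOf hI (fun r hr => hF r (hIJ hr)) (fun r _ => hFO r)
          (fun r hr => hX r (hIJ hr)) hwγ ht
          ((hw.contDiffAt (hI.mem_nhds ht)).differentiableAt (by simp)) hw'
      have hu0 := hzero u hu (fun r hr => by
        rw [huv r hr]; exact Submodule.subset_span (by simp)) hu'
      have hv0 := hzero v hv (fun r hr => by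
        rw [huv r hr]; exact Submodule.subset_span (by simp)) hv'
      have h2 := (γ t).2.1
      have hbot : (γ t).1 = ⊥ := by
        rw [huv t ht, hu0, hv0]
        simp
      rw [hbot, finrank_bot] at h2
      norm_num at h2
    · intro I A hIJ hA t ht
      refine contact_ne_zero hA.isOpen
        (hasDerivAt_changeOfFrame (fun r hr => (hX r (hIJ hr)).infinitesimal)
          (fun r hr => hF r (hIJ hr)) (fun r hr => hA.hasDerivAt hr))
        (fun r hr => mul_mem_O42 (formInv_mem_O42 (hFO r)) (hA.mem_O42 hr))
        (fun r hr => preservesPlane_formInv_mul (hFO r) (hA.span_eq r hr)) ht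
        (hX t (hIJ ht)).infinitesimal (hA.isInfinitesimal ht)
        (hX t (hIJ ht)).h21 (hX t (hIJ ht)).h31 (hX t (hIJ ht)).pos.ne'
  refine ⟨γ, ⟨⟨hT, fun t ht => ?_⟩, fun t ht => ?_⟩, fun t ht => ?_, fun t ht => ?_⟩
  · refine ⟨J, F, ht, subset_rfl, hframe.toIsFirstOrderFrame, ?_⟩
    rw [hframe.P_eq t ht]
    simp
  · refine ⟨J, F, ht, subset_rfl, hframe.toIsThirdOrderFrame, ?_⟩
    -- For this frame `q = -κ₁`.
    have hq : q F t ≠ 0 := by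
      rw [q, hθ t ht]
      simpa [hXdef, curvatureForm, (hs' t ht).ne'] using hκ₁_ne t ht
    positivity
  · refine ⟨J, F, ht, subset_rfl, hframe.toIsSecondOrderFrame, fun r hr => ?_⟩
    rw [hθ r hr]
    have hsd := ((hs.contDiffAt (hJ.mem_nhds hr)).differentiableAt (by simp)).hasDerivAt
    simpa [hXdef, curvatureForm] using hsd
  · refine ⟨J, F, ht, subset_rfl, hframe, fun r hr => ?_⟩
    rw [hθ r hr]
    simp [hXdef, curvatureForm, mul_comm]

end Existence

end LieSphere

end

theorem theoremA (J : Set ℝ) (hJ : IsOpen J) (hJc : IsConnected J)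
    (s κ₁ κ₂ κ₃ κ₄ : ℝ → ℝ)
    (hs : ContDiffOn ℝ ∞ s J) (hs' : ∀ t ∈ J, 0 < deriv s t)
    (hκ₁ : ContDiffOn ℝ ∞ κ₁ J) (hκ₂ : ContDiffOn ℝ ∞ κ₂ J)
    (hκ₃ : ContDiffOn ℝ ∞ κ₃ J) (hκ₄ : ContDiffOn ℝ ∞ κ₄ J)
    (hκ₁_ne : ∀ t ∈ J, κ₁ t ≠ 0) :
    (∃ γ : ℝ → LieSphere.NullPlane,
      LieSphere.IsGeneric J γ ∧ LieSphere.IsLieArclength J γ s ∧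
        LieSphere.AreLieCurvatures J γ κ₁ κ₂ κ₃ κ₄) ∧
    (∀ γ γ' : ℝ → LieSphere.NullPlane,
      LieSphere.IsGeneric J γ → LieSphere.IsLieArclength J γ s →
      LieSphere.AreLieCurvatures J γ κ₁ κ₂ κ₃ κ₄ →
      LieSphere.IsGeneric J γ' → LieSphere.IsLieArclength J γ' s →
      LieSphere.AreLieCurvatures J γ' κ₁ κ₂ κ₃ κ₄ →
      ∃ g ∈ LieSphere.G, ∀ t ∈ J, (γ' t).1 = (γ t).1.map (Matrix.toLin' g)) := by

  have hX := LieSphere.contDiffOn_curvatureForm hJ hs hκ₁ hκ₂ hκ₃ hκ₄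
  obtain ⟨F, hFG, hF⟩ := LieSphere.exists_frame hJ hJc hX fun t ht =>
    (LieSphere.isSecondOrderForm_curvatureForm (hs' t ht)).infinitesimal
  refine ⟨LieSphere.exists_curve hJ hs hs' hκ₁ hκ₂ hκ₃ hκ₄ hκ₁_ne hFG hF, ?_⟩
  intro γ γ' _ hs₁ hκ _ hs₂ hκ'
  obtain ⟨c, hc, hγ⟩ := LieSphere.exists_eq_planeOf_mul hJc hs' hκ₁_ne hFG hF hs₁ hκ
  obtain ⟨c', hc', hγ'⟩ := LieSphere.exists_eq_planeOf_mul hJc hs' hκ₁_ne hFG hF hs₂ hκ'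
  refine ⟨c' * LieSphere.formInv c, LieSphere.mul_mem_G hc' (LieSphere.formInv_mem_G hc),
    fun t ht => ?_⟩
  rw [hγ t ht, hγ' t ht, ← LieSphere.planeOf_mul, Matrix.mul_assoc c',
    ← Matrix.mul_assoc (LieSphere.formInv c),
    LieSphere.formInv_mul (LieSphere.mem_O42_of_mem_G hc), Matrix.one_mul]
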